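/- **Conventions.** Let $n=1$. Write $\langle x\rangle=(1+|x|^2)^{1/2}$. In the nonperiodic case $x\in\mathbb R$ and $\mu$ is Lebesgue measure on $\mathbb R$; in the periodic case $x\in\mathbb T=\mathbb R/2\pi\mathbb Z$ and $\mu$ is the counting measure on $\mathbb Z$. In both cases $t\in\mathbb R$, and $\mathcal F f(\xi,\tau)=\iint e^{-i(x\xi+t\tau)}f(x,t)\,dx\,dt$ denotes the Fourier transform in space and time (extended to tempered distributions, with $\xi\in\mathbb R$ respectively $\xi\in\mathbb Z$). For $s,b\in\mathbb R$ put $$\|f\|_{X^+_{s,b}}=\Big(\int\mu(d\xi)\int d\tau\,\langle\xi\rangle^{2s}\langle\tau+\xi^2\rangle^{2b}|\mathcal F f(\xi,\tau)|^2\Big)^{1/2},$$ $$\|f\|_{Y_s}=\Big(\int\mu(d\xi)\,\langle\xi\rangle^{2s}\Big(\int d\tau\,\langle\tau+\xi^2\rangle^{-1}|\mathcal F f(\xi,\tau)|\Big)^2\Big)^{1/2},$$ and, for $s,b\ge 0$, let $X^+_{s,b}$ be the space of all $f\in L^2_{xt}$ with $\|f\|_{X^+_{s,b}}<\infty$. **Theorem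 3.1.** Let $\theta\in(0,\tfrac14)$ and $s\ge 0$. There is a constant $c=c(\theta,s)>0$ such that, both in the nonperiodic and in the periodic case, for all $T>0$ and all $u_1,u_2\in X^+_{s,1/2}$ supported in $\{(x,t):|t|\le T\}$, i) $\displaystyle \|\partial_x(\overline{u}_1\overline{u}_2)\|_{X^+_{s,-1/2}}\le c\,T^{\theta}\,\|u_1\|_{X^+_{s,1/2}}\|u_2\|_{X^+_{s,1/2}}$, and ii) $\displaystyle \|\partial_x(\overline{u}_1\overline{u}_2)\|_{Y_s}\le c\,T^{\theta}\,\|u_1\|_{X^+_{s,1/2}}\|u_2\|_{X^+_{s,1/2}}$. Here $\partial_x$ is the derivative in the sense of distributions. -/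

import Mathlib

open MeasureTheory
open scoped SchwartzMap LineDeriv ENNReal ComplexConjugate FourierTransform

noncomputable section

namespace BourgainSpace

instance factTwoPiPos : Fact (0 < 2 * Real.pi) := ⟨Real.two_pi_pos⟩

/-- The bracket `⟨x⟩ = (1 + |x|²)^{1/2}`. -/
def bracket (x : ℝ) : ℝ := Real.sqrt (1 + x ^ 2)

/-! ### The space-time Fourier transform

Points of space-time are pairs `(x, t)`, points on the frequency side are pairs `(ξ, τ)`. -/

/-- The linear change of variables `(x, t) ↦ (x / 2π, t / 2π)`, as a map to the Euclidean plane. -/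
def scaleEquiv : (ℝ × ℝ) ≃L[ℝ] WithLp 2 (ℝ × ℝ) :=
  (ContinuousLinearEquiv.smulLeft (Units.mk0 ((2 * Real.pi)⁻¹ : ℝ)
    (inv_ne_zero Real.two_pi_pos.ne'))).trans (WithLp.prodContinuousLinearEquiv 2 ℝ ℝ ℝ).symm

/-- The Fourier transform `φ ↦ ((x, t) ↦ ∫∫ e^{-i(xξ + tτ)} φ(ξ, τ) dξ dτ)` on Schwartz functions of
two variables; see `schwartzFourier_apply`. It is assembled from the Fourier transform of Mathlib,
whose kernel is `e^{-2πi(xξ + tτ)}`. -/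
def schwartzFourier : 𝓢(ℝ × ℝ, ℂ) →L[ℂ] 𝓢(ℝ × ℝ, ℂ) :=
  (SchwartzMap.compCLMOfContinuousLinearEquiv ℂ scaleEquiv).comp
    ((SchwartzMap.fourierTransformCLM ℂ).comp
      (SchwartzMap.compCLMOfContinuousLinearEquiv ℂ (WithLp.prodContinuousLinearEquiv 2 ℝ ℝ ℝ)))

theorem schwartzFourier_apply (φ : 𝓢(ℝ × ℝ, ℂ)) (p : ℝ × ℝ) :
    schwartzFourier φ p =
      ∫ q : ℝ × ℝ, Complex.exp (-(Complex.I * ((p.1 * q.1 + p.2 * q.2 : ℝ) : ℂ))) * φ q := by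
  have h1 : schwartzFourier φ p = ∫ v : WithLp 2 (ℝ × ℝ),
      Real.fourierChar (-inner ℝ v (scaleEquiv p)) • φ (WithLp.ofLp v) := rfl
  rw [h1, ← (WithLp.volume_preserving_ofLp ℝ ℝ).integral_comp
    (WithLp.homeomorphProd 2 ℝ ℝ).measurableEmbedding]
  refine integral_congr_ae (Filter.Eventually.of_forall fun v => ?_)
  have h2 : inner ℝ v (scaleEquiv p) =
      (2 * Real.pi)⁻¹ * (p.1 * (WithLp.ofLp v).1 + p.2 * (WithLp.ofLp v).2) := by
    have h3 : WithLp.ofLp (scaleEquiv p) = (2 * Real.pi)⁻¹ • p := rfl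
    rw [WithLp.prod_inner_apply, h3]
    simp only [Prod.smul_fst, Prod.smul_snd, smul_eq_mul, RCLike.inner_apply, conj_trivial]
    ring
  simp only [h2, Circle.smul_def, Real.fourierChar_apply, smul_eq_mul]
  congr 2
  have := Real.pi_ne_zero
  have hpi : (Real.pi : ℂ) ≠ 0 := by exact_mod_cast this
  push_cast
  field_simp

/-- The function `h` on the frequency side is the Fourier transform of the tempered distribution `Λ`
on space-time, with respect to the measure `μ(dξ) dτ`: the transform of `Λ`, which is given by
`φ ↦ Λ (ℱ φ)`, is integration against `h(ξ, τ) μ(dξ) dτ`.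

For `μ` the Lebesgue measure this says that `h` is the Fourier transform of `Λ` on `ℝ × ℝ`. If `Λ` is
`2π`-periodic in `x` and `μ` is the counting measure on `ℤ`, it says that `h(k, ·)`, for `k : ℤ`, is
the Fourier transform in `t` of the `k`-th Fourier coefficient of `Λ` in `x`
(`h(k, τ) = ∫_ℝ ∫_0^{2π} e^{-i(kx + tτ)} u(x, t) dx dt` if `Λ` is a nice function `u`). -/
def HasFourierTransform (μ : Measure ℝ) (Λ : 𝓢'(ℝ × ℝ, ℂ)) (h : ℝ × ℝ → ℂ) : Prop :=
  AEStronglyMeasurable h (μ.prod volume) ∧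
    ∀ φ : 𝓢(ℝ × ℝ, ℂ), Integrable (fun q => φ q * h q) (μ.prod volume) ∧
      Λ (schwartzFourier φ) = ∫ q, φ q * h q ∂(μ.prod volume)

/-- The `X⁺_{s,b}` norm `‖⟨ξ⟩^s ⟨τ + ξ²⟩^b ℱΛ‖_{L²_{ξτ}}` (in `[0, ∞]`; it is `∞` if `ℱΛ` is not
a function). The Fourier transform is unique up to null sets, so the infimum is over one class. -/
def xNorm (μ : Measure ℝ) (s b : ℝ) (Λ : 𝓢'(ℝ × ℝ, ℂ)) : ℝ≥0∞ :=
  ⨅ (h : ℝ × ℝ → ℂ) (_ : HasFourierTransform μ Λ h),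
    eLpNorm (fun q : ℝ × ℝ => ((bracket q.1 ^ s * bracket (q.2 + q.1 ^ 2) ^ b : ℝ) : ℂ) * h q)
      2 (μ.prod volume)

/-- The auxiliary norm `‖⟨ξ⟩^s ⟨τ + ξ²⟩^{-1} ℱΛ‖_{L²_ξ(L¹_τ)}` (in `[0, ∞]`). -/
def yNorm (μ : Measure ℝ) (s : ℝ) (Λ : 𝓢'(ℝ × ℝ, ℂ)) : ℝ≥0∞ :=
  ⨅ (h : ℝ × ℝ → ℂ) (_ : HasFourierTransform μ Λ h),
    (∫⁻ ξ : ℝ, ENNReal.ofReal (bracket ξ ^ (2 * s)) *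
      (∫⁻ τ : ℝ, ENNReal.ofReal ((bracket (τ + ξ ^ 2))⁻¹) * ‖h (ξ, τ)‖ₑ) ^ 2 ∂μ) ^ (1 / 2 : ℝ)

/-! ### Functions as tempered distributions -/

/-- `u` is integrable against some power of `1 + |(x, t)|`. -/
def IsTempered (u : ℝ × ℝ → ℂ) : Prop :=
  ∃ N : ℕ, Integrable (fun p => (((1 + ‖p‖) ^ N)⁻¹ : ℝ) • u p) volume

theorem decay_bound (N : ℕ) : ∃ (S : Finset (ℕ × ℕ)) (C : ℝ), 0 ≤ C ∧
    ∀ (φ : 𝓢(ℝ × ℝ, ℂ)) (p : ℝ × ℝ),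
      (1 + ‖p‖) ^ N * ‖φ p‖ ≤ C * S.sup (schwartzSeminormFamily ℂ (ℝ × ℝ) ℂ) φ := by
  refine ⟨Finset.Iic (N, 0), 2 ^ N, by positivity, fun φ p => ?_⟩
  have h := SchwartzMap.one_add_le_sup_seminorm_apply (𝕜 := ℂ) (m := (N, 0)) (k := N) (n := 0)
    le_rfl le_rfl φ p
  rwa [norm_iteratedFDeriv_zero] at h

theorem IsTempered.integrable_mul {u : ℝ × ℝ → ℂ} (hu : IsTempered u) (φ : 𝓢(ℝ × ℝ, ℂ)) :
    Integrable (fun p => φ p * u p) volume := by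
  obtain ⟨N, hN⟩ := hu
  obtain ⟨S, C, hC, hb⟩ := decay_bound N
  have h := hN.bdd_mul (f := fun p => (((1 + ‖p‖) ^ N : ℝ) : ℂ) * φ p)
    (c := C * S.sup (schwartzSeminormFamily ℂ (ℝ × ℝ) ℂ) φ)
    (by
      refine Continuous.aestronglyMeasurable ?_
      have := φ.continuous
      fun_prop)
    (Filter.Eventually.of_forall fun p => by
      rw [norm_mul, Complex.norm_real, Real.norm_of_nonneg (by positivity)]
      exact hb φ p)
  refine h.congr (Filter.Eventually.of_forall fun p => ?_)
  have h0 : (((1 + ‖p‖ : ℝ) : ℂ)) ≠ 0 := by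
    exact_mod_cast (by positivity : (1 + ‖p‖ : ℝ) ≠ 0)
  simp only [Complex.real_smul]
  push_cast at h0 ⊢
  field_simp

theorem IsTempered.exists_bound {u : ℝ × ℝ → ℂ} (hu : IsTempered u) :
    ∃ (S : Finset (ℕ × ℕ)) (C : ℝ), 0 ≤ C ∧ ∀ φ : 𝓢(ℝ × ℝ, ℂ),
      ‖∫ p, φ p * u p‖ ≤ C * S.sup (schwartzSeminormFamily ℂ (ℝ × ℝ) ℂ) φ := by
  obtain ⟨N, hN⟩ := hu
  obtain ⟨S, C, hC, hb⟩ := decay_bound N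
  refine ⟨S, C * ∫ p, ‖(((1 + ‖p‖) ^ N)⁻¹ : ℝ) • u p‖, by positivity, fun φ => ?_⟩
  rw [mul_right_comm, ← integral_const_mul]
  refine norm_integral_le_of_norm_le (hN.norm.const_mul _)
    (Filter.Eventually.of_forall fun p => ?_)
  have h0 : 0 < (1 + ‖p‖) ^ N := by positivity
  have h1 := hb φ p
  rw [norm_mul, norm_smul, Real.norm_of_nonneg (by positivity)]
  calc ‖φ p‖ * ‖u p‖ = ((1 + ‖p‖) ^ N * ‖φ p‖) * (((1 + ‖p‖) ^ N)⁻¹ * ‖u p‖) := by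
        field_simp
    _ ≤ _ := by gcongr

open Classical in
/-- The tempered distribution `φ ↦ ∫∫ φ u dx dt` defined by a function `u` (and `0` if `u` is not
tempered; `L^p` functions and functions that are periodic in `x` and `L^p` over one period are). -/
def toDistribution (u : ℝ × ℝ → ℂ) : 𝓢'(ℝ × ℝ, ℂ) :=
  if hu : IsTempered u then
    ContinuousLinearMap.toPointwiseConvergenceCLM _ _ _ _
      (SchwartzMap.mkCLMtoNormedSpace (𝕜 := ℂ) (σ := RingHom.id ℂ)
        (fun φ : 𝓢(ℝ × ℝ, ℂ) => ∫ p, φ p * u p)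
        (fun φ ψ => by
          simp only [_root_.add_apply, add_mul]
          exact integral_add (hu.integrable_mul φ) (hu.integrable_mul ψ))
        (fun a φ => by
          simp only [_root_.smul_apply, smul_eq_mul, mul_assoc, RingHom.id_apply]
          exact integral_const_mul _ _)
        hu.exists_bound)
  else 0

theorem toDistribution_apply {u : ℝ × ℝ → ℂ} (hu : IsTempered u) (φ : 𝓢(ℝ × ℝ, ℂ)) :
    toDistribution u φ = ∫ p, φ p * u p := by
  rw [toDistribution, dif_pos hu]
  rfl

/-! ### The nonperiodic and the periodic setting -/

/-- The pointwise product `ū₁ ū₂`. -/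
def conjMul {M : Type*} (u₁ u₂ : M → ℂ) : M → ℂ := fun p => conj (u₁ p) * conj (u₂ p)

/-- The circle `𝕋 = ℝ / 2πℤ`. -/
abbrev Torus : Type := AddCircle (2 * Real.pi)

/-- The counting measure on `ℤ`, as a measure on the frequency line. -/
def intMeasure : Measure ℝ := Measure.map (fun k : ℤ => (k : ℝ)) Measure.count

/-- A function on `𝕋 × ℝ`, regarded as a function on `ℝ × ℝ` that is `2π`-periodic in `x`. -/
def lift (u : Torus × ℝ → ℂ) : ℝ × ℝ → ℂ := fun p => u ((p.1 : Torus), p.2)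

/-- The `X⁺_{s,b}` norm of a function on `ℝ × ℝ`. -/
def xNormLine (s b : ℝ) (u : ℝ × ℝ → ℂ) : ℝ≥0∞ := xNorm volume s b (toDistribution u)

/-- The `X⁺_{s,b}` norm of a function on `𝕋 × ℝ`. -/
def xNormTorus (s b : ℝ) (u : Torus × ℝ → ℂ) : ℝ≥0∞ := xNorm intMeasure s b (toDistribution (lift u))

/-- `u ∈ X⁺_{s,b}` in the nonperiodic setting, for `s, b ≥ 0` (so that `X⁺_{s,b} ⊆ L²_{xt}`). -/
def MemXLine (s b : ℝ) (u : ℝ × ℝ → ℂ) : Prop := MemLp u 2 volume ∧ xNormLine s b u < ∞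

/-- `u ∈ X⁺_{s,b}` in the periodic setting, for `s, b ≥ 0` (so that `X⁺_{s,b} ⊆ L²_{xt}`). -/
def MemXTorus (s b : ℝ) (u : Torus × ℝ → ℂ) : Prop := MemLp u 2 volume ∧ xNormTorus s b u < ∞

/-- The distribution `∂ₓ u`, for a function `u` on `ℝ × ℝ`. -/
def dxLine (u : ℝ × ℝ → ℂ) : 𝓢'(ℝ × ℝ, ℂ) := ∂_{((1 : ℝ), (0 : ℝ))} (toDistribution u)

/-- The distribution `∂ₓ u`, for a function `u` on `𝕋 × ℝ`. -/
def dxTorus (u : Torus × ℝ → ℂ) : 𝓢'(ℝ × ℝ, ℂ) := dxLine (lift u)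

/-- `u(x, t) = 0` for almost all `(x, t)` with `|t| > T`, i.e. the support of `u`, as a distribution,
lies in `{|t| ≤ T}`. -/
def SupportedIn {M : Type*} [MeasureSpace M] (T : ℝ) (u : M × ℝ → ℂ) : Prop :=
  ∀ᵐ p : M × ℝ, T < |p.2| → u p = 0

end BourgainSpace

end

/-!
Why the theorem is true. On the frequency side `∂ₓ(ū₁ ū₂)` is `iξ` times a convolution of the
conjugated transforms of the factors, over all pairs of frequencies with `Q + q₁ + q₂ = 0`; both
conjugates reverse the sign of the frequency. For such triples the three modulations `τ + ξ²` add up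
to the sum of the squares of the three spatial frequencies, without any cancellation, so the largest
of them is at least of the order `⟨ξ⟩²`, where `ξ` is the output frequency
(`sq_bracket_le_of_add_eq_zero`). One half power of this modulation pays for the derivative, and the
weight `⟨ξ⟩^s` is distributed over the two factors (`crossConv_weight_le`).

What is left are `L²` bounds for the convolution. By Cauchy's inequality they reduce to a uniform
bound for `∫ ⟨m(-a - z)⟩^{-p} ⟨m(z)⟩^{-q} μ(dξ) dτ`, with `z = (ξ, τ)` and `m` the modulation
(`exists_kernel_bound`). The integral in `τ` leaves the power `-α` of a quadratic polynomial in `ξ`,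
which is integrable for `α > 1 / 2`; such an `α` exists as soon as `p + q > 3 / 2`. So `p` can be
taken a little below `1`, and one of the factors `uᵢ` needs only the weight `⟨m⟩^{q/2}` for some
`q > 1 / 2` (`exists_bilinear_bound`). Having `p < 1` also leaves an integrable power of `⟨m⟩` for
the `Y_s` norm, by Cauchy's inequality in `τ`. If the output modulation is the largest, no such
power is left, but then `⟨ξ⟩² ⟨m⟩⁻²` is integrable in `τ`, uniformly in `ξ`
(`exists_lintegral_outputRegion_le`).

The power of `T` comes from the gap between `q` and `1`. A function supported in `|t| ≤ T` has a
Fourier transform that is spread over scales `1 / T` in `τ`, in the sense that its square is bounded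
by a multiple of `T` times its integral in `τ` (`exists_ae_sq_le`). So, lowering the weight from
`⟨m⟩` to `⟨m⟩^q` in the squared norm gains `T^{1-q}` (`exists_energy_le`), and `q = 1 - 2θ > 1 / 2`
gives the factor `T^θ` in the norm.

Both settings are treated at once, for a measure `μ` on the frequency line that is invariant under
the relevant reflections and locally no denser than Lebesgue measure (`IsFrequencyMeasure`). The
product formula itself (`hasFourierTransform_dxLine_conjMul`) has to be proved for functions that
may be periodic in `x`. It is derived from Parseval's formula for each factor: averaged over
translates of one factor against a Schwartz weight, all integrals converge absolutely, and the
weight can then be concentrated at the origin, because translation is continuous in `L²`.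
-/

open MeasureTheory
open scoped SchwartzMap LineDeriv ENNReal ComplexConjugate FourierTransform

noncomputable section

namespace BourgainSpace

/-! ### The Fourier transform on Schwartz functions -/

/-- The character `e^{-i(xξ + tτ)}` of the plane. -/
def wave (p q : ℝ × ℝ) : ℂ := Complex.exp (-(Complex.I * ((p.1 * q.1 + p.2 * q.2 : ℝ) : ℂ)))

theorem wave_comm (p q : ℝ × ℝ) : wave p q = wave q p := by
  simp only [wave, mul_comm]

theorem wave_add (p q r : ℝ × ℝ) : wave p (q + r) = wave p q * wave p r := by
  simp only [wave, ← Complex.exp_add]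
  congr 1
  simp only [Prod.fst_add, Prod.snd_add]
  push_cast
  ring

theorem norm_wave (p q : ℝ × ℝ) : ‖wave p q‖ = 1 := by
  have h : wave p q = Complex.exp (((-(p.1 * q.1 + p.2 * q.2) : ℝ) : ℂ) * Complex.I) := by
    rw [wave]
    congr 1
    push_cast
    ring
  rw [h, Complex.norm_exp_ofReal_mul_I]

theorem conj_wave (p q : ℝ × ℝ) : conj (wave p q) = wave (-p) q := by
  rw [wave, wave, ← Complex.exp_conj]
  congr 1
  simp only [map_neg, map_mul, Complex.conj_I, Complex.conj_ofReal, Prod.fst_neg, Prod.snd_neg]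
  push_cast
  ring

theorem continuous_wave : Continuous fun z : (ℝ × ℝ) × (ℝ × ℝ) => wave z.1 z.2 := by
  unfold wave
  fun_prop

theorem schwartzFourier_eq_integral_wave (φ : 𝓢(ℝ × ℝ, ℂ)) (p : ℝ × ℝ) :
    schwartzFourier φ p = ∫ q : ℝ × ℝ, wave p q * φ q :=
  schwartzFourier_apply φ p

theorem schwartzFourier_compSubConst (φ : 𝓢(ℝ × ℝ, ℂ)) (a p : ℝ × ℝ) :
    schwartzFourier (φ.compSubConstCLM ℂ a) p = wave p a * schwartzFourier φ p := by
  rw [schwartzFourier_eq_integral_wave, schwartzFourier_eq_integral_wave,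
    ← integral_add_right_eq_self _ a, ← integral_const_mul]
  congr 1
  ext q
  simp only [SchwartzMap.compSubConstCLM_apply, add_sub_cancel_right, wave_add]
  ring

/-- Fourier inversion, in the form `ℱ ℱ φ = (2π)² φ(-·)`. -/
theorem schwartzFourier_schwartzFourier (φ : 𝓢(ℝ × ℝ, ℂ)) (p : ℝ × ℝ) :
    schwartzFourier (schwartzFourier φ) p = (((2 * Real.pi) ^ 2 : ℝ) : ℂ) * φ (-p) := by
  set f : 𝓢(WithLp 2 (ℝ × ℝ), ℂ) :=
    SchwartzMap.compCLMOfContinuousLinearEquiv ℂ (WithLp.prodContinuousLinearEquiv 2 ℝ ℝ ℝ) φ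
    with hf
  have hpi := Real.pi_pos
  have h1 : schwartzFourier (schwartzFourier φ) p = ∫ v : WithLp 2 (ℝ × ℝ),
      Real.fourierChar (-inner ℝ v (scaleEquiv p)) • (𝓕 f) (scaleEquiv (WithLp.ofLp v)) := rfl
  have h2 : ∀ v : WithLp 2 (ℝ × ℝ), scaleEquiv (WithLp.ofLp v) = (2 * Real.pi)⁻¹ • v :=
    fun v => rfl
  set g : WithLp 2 (ℝ × ℝ) → ℂ := fun w =>
    Real.fourierChar (-inner ℝ w (WithLp.toLp 2 p)) • (𝓕 f) w with hg
  have h4 : ∀ v : WithLp 2 (ℝ × ℝ),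
      Real.fourierChar (-inner ℝ v (scaleEquiv p)) • (𝓕 f) (scaleEquiv (WithLp.ofLp v)) =
        g ((2 * Real.pi)⁻¹ • v) := by
    intro v
    simp only [hg, h2, inner_smul_left, inner_smul_right, conj_trivial]
  have h5 : Module.finrank ℝ (WithLp 2 (ℝ × ℝ)) = 2 := by
    rw [(WithLp.linearEquiv 2 ℝ (ℝ × ℝ)).finrank_eq]
    simp
  rw [h1, integral_congr_ae (Filter.Eventually.of_forall h4),
    Measure.integral_comp_smul volume g, h5]
  have h6 : ∫ w, g w = f (-WithLp.toLp 2 p) := by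
    have h7 : 𝓕⁻ (𝓕 f) (-WithLp.toLp 2 p) = f (-WithLp.toLp 2 p) := by
      rw [FourierTransform.fourierInv_fourier_eq]
    rw [← h7, SchwartzMap.fourierInv_coe, Real.fourierInv_eq]
    simp only [inner_neg_right]
    rfl
  rw [h6]
  have h8 : f (-WithLp.toLp 2 p) = φ (-p) := rfl
  rw [h8, Complex.real_smul, abs_of_pos (by positivity)]
  rw [inv_pow, inv_inv]

/-- The complex conjugate of a Schwartz function. -/
def schwartzConj (φ : 𝓢(ℝ × ℝ, ℂ)) : 𝓢(ℝ × ℝ, ℂ) :=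
  φ.postcompCLM (Complex.conjCLE : ℂ →L[ℝ] ℂ)

theorem schwartzConj_apply (φ : 𝓢(ℝ × ℝ, ℂ)) (p : ℝ × ℝ) : schwartzConj φ p = conj (φ p) := rfl

theorem schwartzFourier_conj (φ : 𝓢(ℝ × ℝ, ℂ)) (p : ℝ × ℝ) :
    schwartzFourier (schwartzConj φ) p = conj (schwartzFourier φ (-p)) := by
  rw [schwartzFourier_eq_integral_wave, schwartzFourier_eq_integral_wave, ← integral_conj]
  congr 1
  ext q
  rw [map_mul, conj_wave, neg_neg, schwartzConj_apply]

/-- Multiplication of a Schwartz function on the frequency side by the frequency variable `ξ`. -/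
def mulFreq : 𝓢(ℝ × ℝ, ℂ) →L[ℂ] 𝓢(ℝ × ℝ, ℂ) :=
  SchwartzMap.smulLeftCLM ℂ (fun q : ℝ × ℝ => (q.1 : ℂ))

theorem mulFreq_apply (φ : 𝓢(ℝ × ℝ, ℂ)) (q : ℝ × ℝ) : mulFreq φ q = (q.1 : ℂ) * φ q := by
  have h : Function.HasTemperateGrowth (fun q : ℝ × ℝ => (q.1 : ℂ)) :=
    (Complex.ofRealCLM.comp (ContinuousLinearMap.fst ℝ ℝ ℝ)).hasTemperateGrowth
  rw [mulFreq, SchwartzMap.smulLeftCLM_apply_apply h, smul_eq_mul]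

/-- Differentiation of a Fourier transform in `x` is multiplication by `-iξ` on the other side. -/
theorem lineDerivOp_schwartzFourier (φ : 𝓢(ℝ × ℝ, ℂ)) :
    ∂_{((1 : ℝ), (0 : ℝ))} (schwartzFourier φ) = schwartzFourier (-(Complex.I • mulFreq φ)) := by
  set f : 𝓢(WithLp 2 (ℝ × ℝ), ℂ) :=
    SchwartzMap.compCLMOfContinuousLinearEquiv ℂ (WithLp.prodContinuousLinearEquiv 2 ℝ ℝ ℝ) φ
    with hf
  have h1 : schwartzFourier φ = SchwartzMap.compCLMOfContinuousLinearEquiv ℂ scaleEquiv (𝓕 f) := rfl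
  have hg : (inner ℝ · (scaleEquiv ((1 : ℝ), (0 : ℝ)))).HasTemperateGrowth :=
    ((innerSL ℝ).flip (scaleEquiv ((1 : ℝ), (0 : ℝ)))).hasTemperateGrowth
  have h2 : -(2 * (Real.pi : ℂ) * Complex.I) • SchwartzMap.smulLeftCLM ℂ
      (inner ℝ · (scaleEquiv ((1 : ℝ), (0 : ℝ)))) f =
      SchwartzMap.compCLMOfContinuousLinearEquiv ℂ (WithLp.prodContinuousLinearEquiv 2 ℝ ℝ ℝ)
        (-(Complex.I • mulFreq φ)) := by
    ext v
    have h3 : inner ℝ v (scaleEquiv ((1 : ℝ), (0 : ℝ))) = (2 * Real.pi)⁻¹ * (WithLp.ofLp v).1 := by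
      have h4 : WithLp.ofLp (scaleEquiv ((1 : ℝ), (0 : ℝ))) =
          (2 * Real.pi)⁻¹ • ((1 : ℝ), (0 : ℝ)) := rfl
      rw [WithLp.prod_inner_apply, h4]
      simp
    have h5 : SchwartzMap.compCLMOfContinuousLinearEquiv ℂ
        (WithLp.prodContinuousLinearEquiv 2 ℝ ℝ ℝ) (-(Complex.I • mulFreq φ)) v =
        -(Complex.I * mulFreq φ (WithLp.ofLp v)) := rfl
    rw [h5, mulFreq_apply]
    have h6 : (-(2 * (Real.pi : ℂ) * Complex.I) • SchwartzMap.smulLeftCLM ℂ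
      (inner ℝ · (scaleEquiv ((1 : ℝ), (0 : ℝ)))) f) v = -(2 * (Real.pi : ℂ) * Complex.I) *
      (SchwartzMap.smulLeftCLM ℂ (inner ℝ · (scaleEquiv ((1 : ℝ), (0 : ℝ)))) f v) := rfl
    rw [h6, SchwartzMap.smulLeftCLM_apply_apply hg, h3, Complex.real_smul]
    have h7 : f v = φ (WithLp.ofLp v) := rfl
    have hpi : (Real.pi : ℂ) ≠ 0 := by exact_mod_cast Real.pi_ne_zero
    rw [h7]
    push_cast
    field_simp
  rw [h1, SchwartzMap.lineDerivOp_compCLMOfContinuousLinearEquiv, SchwartzMap.lineDerivOp_fourier_eq,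
    h2]
  rfl

/-! ### Brackets -/

theorem one_le_bracket (x : ℝ) : 1 ≤ bracket x := by
  rw [bracket, Real.one_le_sqrt]
  nlinarith [sq_nonneg x]

theorem bracket_pos (x : ℝ) : 0 < bracket x := zero_lt_one.trans_le (one_le_bracket x)

theorem bracket_sq (x : ℝ) : bracket x ^ 2 = 1 + x ^ 2 := Real.sq_sqrt (by positivity)

theorem continuous_bracket : Continuous bracket := by
  unfold bracket
  fun_prop

theorem bracket_neg (x : ℝ) : bracket (-x) = bracket x := by
  simp [bracket]

theorem abs_le_bracket (x : ℝ) : |x| ≤ bracket x :=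
  Real.abs_le_sqrt (by linarith)

theorem bracket_le_one_add_abs (x : ℝ) : bracket x ≤ 1 + |x| := by
  rw [bracket, Real.sqrt_le_left (by positivity)]
  nlinarith [abs_nonneg x, sq_abs x]

theorem one_add_abs_le_bracket (x : ℝ) : 1 + |x| ≤ 2 * bracket x := by
  linarith [one_le_bracket x, abs_le_bracket x]

theorem bracket_le_of_abs_le {x y : ℝ} (h : |x| ≤ |y|) : bracket x ≤ bracket y :=
  Real.sqrt_le_sqrt (by linarith [sq_le_sq.mpr h])

theorem bracket_add_le (x y : ℝ) : bracket (x + y) ≤ 2 * (bracket x * bracket y) := by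
  have hx := one_le_bracket x
  have hy := one_le_bracket y
  refine abs_le_of_sq_le_sq' ?_ (by positivity) |>.2
  rw [mul_pow, mul_pow, bracket_sq, bracket_sq, bracket_sq]
  nlinarith [sq_nonneg (x - y), mul_nonneg (sq_nonneg x) (sq_nonneg y)]

/-- Schwartz functions decay quadratically in each variable separately. -/
theorem exists_decay (φ : 𝓢(ℝ × ℝ, ℂ)) :
    ∃ C : ℝ, 0 ≤ C ∧ ∀ q, ‖φ q‖ ≤ C * (bracket q.1 ^ (-2 : ℝ) * bracket q.2 ^ (-2 : ℝ)) := by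
  obtain ⟨S, C, hC, hb⟩ := decay_bound 4
  refine ⟨C * S.sup (schwartzSeminormFamily ℂ (ℝ × ℝ) ℂ) φ, by positivity, fun q => ?_⟩
  have h := hb φ q
  have h1 : bracket q.1 ≤ 1 + ‖q‖ := (bracket_le_one_add_abs _).trans (by
    gcongr; exact norm_fst_le q)
  have h2 : bracket q.2 ≤ 1 + ‖q‖ := (bracket_le_one_add_abs _).trans (by
    gcongr; exact norm_snd_le q)
  have p1 := bracket_pos q.1
  have p2 := bracket_pos q.2
  rw [Real.rpow_neg p1.le, Real.rpow_neg p2.le, ← mul_inv, ← div_eq_mul_inv,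
    le_div_iff₀ (by positivity),
    mul_comm]
  refine le_trans ?_ h
  gcongr
  rw [Real.rpow_two, Real.rpow_two]
  calc bracket q.1 ^ 2 * bracket q.2 ^ 2 ≤ (1 + ‖q‖) ^ 2 * (1 + ‖q‖) ^ 2 := by gcongr
    _ = _ := by ring

/-! ### Frequency measures -/

section

/-- The bracket `⟨x⟩` with values in `[0, ∞]`, for use in Lebesgue integrals. -/
def jap (x : ℝ) : ℝ≥0∞ := ENNReal.ofReal (bracket x)

theorem one_le_jap (x : ℝ) : 1 ≤ jap x := ENNReal.one_le_ofReal.mpr (one_le_bracket x)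

theorem jap_ne_zero (x : ℝ) : jap x ≠ 0 := (zero_lt_one.trans_le (one_le_jap x)).ne'

theorem jap_ne_top (x : ℝ) : jap x ≠ ⊤ := ENNReal.ofReal_ne_top

theorem jap_rpow (x a : ℝ) : jap x ^ a = ENNReal.ofReal (bracket x ^ a) :=
  ENNReal.ofReal_rpow_of_pos (bracket_pos x)

theorem jap_rpow_ne_zero (x a : ℝ) : jap x ^ a ≠ 0 := by
  rw [jap_rpow]
  exact (ENNReal.ofReal_pos.mpr (Real.rpow_pos_of_pos (bracket_pos x) a)).ne'

theorem jap_rpow_ne_top (x a : ℝ) : jap x ^ a ≠ ⊤ := by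
  rw [jap_rpow]
  exact ENNReal.ofReal_ne_top

theorem jap_rpow_add (x a b : ℝ) : jap x ^ (a + b) = jap x ^ a * jap x ^ b :=
  ENNReal.rpow_add _ _ (jap_ne_zero x) (jap_ne_top x)

theorem jap_rpow_mul_neg (x a : ℝ) : jap x ^ a * jap x ^ (-a) = 1 := by
  rw [← jap_rpow_add, add_neg_cancel, ENNReal.rpow_zero]

theorem jap_rpow_le_of_le (x : ℝ) {a b : ℝ} (h : a ≤ b) : jap x ^ a ≤ jap x ^ b :=
  ENNReal.rpow_le_rpow_of_exponent_le (one_le_jap x) h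

theorem one_le_jap_rpow (x : ℝ) {a : ℝ} (h : 0 ≤ a) : 1 ≤ jap x ^ a := by
  simpa using jap_rpow_le_of_le x h

theorem jap_rpow_sq (x a : ℝ) : (jap x ^ a) ^ 2 = jap x ^ (2 * a) := by
  rw [two_mul, jap_rpow_add, sq]

theorem jap_neg (x : ℝ) : jap (-x) = jap x := by rw [jap, bracket_neg, jap]

theorem measurable_jap : Measurable jap :=
  continuous_bracket.measurable.ennreal_ofReal

@[fun_prop]
theorem Measurable.jap_rpow {α : Type*} [MeasurableSpace α] {f : α → ℝ} (hf : Measurable f)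
    (a : ℝ) : Measurable fun x => jap (f x) ^ a :=
  (measurable_jap.comp hf).pow_const a

theorem ennreal_rpow_le_rpow_of_nonpos {x y : ℝ≥0∞} {a : ℝ} (h : x ≤ y) (ha : a ≤ 0) :
    y ^ a ≤ x ^ a := by
  rw [← neg_neg a, ENNReal.rpow_neg y, ENNReal.rpow_neg x]
  exact ENNReal.inv_le_inv.mpr (ENNReal.rpow_le_rpow h (by linarith))

/-- A measure on the frequency line with respect to which the Fourier transform in `x` is formed:
it is invariant under the reflections `x ↦ -z - x`, for almost all `z`, and no denser than Lebesgue
measure, uniformly over all translates. Both Lebesgue measure and the counting measure on `ℤ` are of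
this kind. -/
class IsFrequencyMeasure (μ : Measure ℝ) : Prop where
  reflect : ∀ᵐ z ∂μ, MeasurePreserving (fun x => -z - x) μ μ
  decay : ∀ p : ℝ, 1 < p → ∃ C : ℝ≥0∞, C ≠ ⊤ ∧ ∀ r, ∫⁻ x, jap (x - r) ^ (-p) ∂μ ≤ C

theorem lintegral_jap_lt_top {p : ℝ} (hp : 1 < p) : ∫⁻ x, jap x ^ (-p) < ⊤ := by
  have h := (integrable_rpow_neg_one_add_norm_sq (E := ℝ) (μ := volume) (r := p)
    (by simpa using hp)).lintegral_lt_top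
  convert h using 4 with x
  rw [jap_rpow, bracket, Real.norm_eq_abs, sq_abs, Real.sqrt_eq_rpow,
    ← Real.rpow_mul (by positivity)]
  congr 2
  ring

instance isFrequencyMeasure_volume : IsFrequencyMeasure volume where
  reflect := Filter.Eventually.of_forall fun z => Measure.measurePreserving_sub_left volume (-z)
  decay p hp := ⟨_, (lintegral_jap_lt_top hp).ne, fun r =>
    (lintegral_sub_right_eq_self (fun x => jap x ^ (-p)) r).le⟩

theorem lintegral_intMeasure {f : ℝ → ℝ≥0∞} (hf : Measurable f) :
    ∫⁻ x, f x ∂intMeasure = ∑' k : ℤ, f k := by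
  rw [intMeasure, lintegral_map hf (measurable_of_countable _), lintegral_count]

instance isFrequencyMeasure_intMeasure : IsFrequencyMeasure intMeasure where
  reflect := by
    have hm : Measurable fun k : ℤ => (k : ℝ) := measurable_of_countable _
    have hs : MeasurableSet (Set.range fun k : ℤ => (k : ℝ)) :=
      (Set.countable_range _).measurableSet
    have h1 : ∀ᵐ z ∂intMeasure, z ∈ Set.range fun k : ℤ => (k : ℝ) := by
      exact (ae_map_iff hm.aemeasurable hs).mpr (Filter.Eventually.of_forall fun k => ⟨k, rfl⟩)
    filter_upwards [h1] with z hz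
    obtain ⟨k, rfl⟩ := hz
    refine ⟨by fun_prop, ?_⟩
    have h2 := (Measure.measurePreserving_sub_left (Measure.count : Measure ℤ) (-k)).map_eq
    rw [intMeasure, Measure.map_map (by fun_prop) hm]
    conv_rhs => rw [← h2, Measure.map_map hm (by fun_prop)]
    congr 1
    ext l
    simp
  decay p hp := by
    refine ⟨4 ^ p * ∫⁻ x, jap x ^ (-p), ENNReal.mul_ne_top (by simp) (lintegral_jap_lt_top hp).ne,
      fun r => ?_⟩
    rw [lintegral_intMeasure (by fun_prop), ← lintegral_sub_right_eq_self (fun x => jap x ^ (-p)) r,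
      ← lintegral_const_mul _ (by fun_prop), ← setLIntegral_univ,
      ← iUnion_Ioc_intCast ℝ, lintegral_iUnion (fun _ => measurableSet_Ioc)
        (Set.pairwise_disjoint_Ioc_intCast ℝ)]
    refine ENNReal.tsum_le_tsum fun k => ?_
    have h1 : jap (k - r) ^ (-p) =
        ∫⁻ _ in Set.Ioc (k : ℝ) (k + 1), jap (k - r) ^ (-p) := by simp
    rw [h1]
    refine setLIntegral_mono (by fun_prop) fun x hx => ?_
    have h2 : jap (x - r) ≤ 4 * jap (k - r) := by
      have h3 : bracket (x - r) ≤ 4 * bracket (k - r) := by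
        have h4 : bracket (x - k) ≤ 2 := (bracket_le_one_add_abs _).trans (by
          have : |x - k| ≤ 1 := abs_le.mpr ⟨by linarith [hx.1], by linarith [hx.2]⟩
          linarith)
        have h5 := bracket_add_le (k - r) (x - k)
        rw [show (k - r + (x - k) : ℝ) = x - r by ring] at h5
        nlinarith [bracket_pos (k - r)]
      calc jap (x - r) ≤ ENNReal.ofReal (4 * bracket (k - r)) := ENNReal.ofReal_le_ofReal h3
        _ = _ := by rw [ENNReal.ofReal_mul (by norm_num), jap]; simp
    calc jap (k - r) ^ (-p) = 4 ^ p * (4 * jap (k - r)) ^ (-p) := by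
          rw [ENNReal.mul_rpow_of_ne_zero (by norm_num) (jap_ne_zero _), ← mul_assoc,
            ← ENNReal.rpow_add _ _ (by norm_num) (by norm_num), add_neg_cancel, ENNReal.rpow_zero,
            one_mul]
      _ ≤ _ := by
          refine mul_le_mul_right ?_ _
          exact ennreal_rpow_le_rpow_of_nonpos h2 (by linarith)

variable {μ : Measure ℝ}

instance (priority := 100) IsFrequencyMeasure.isLocallyFiniteMeasure [IsFrequencyMeasure μ] :
    IsLocallyFiniteMeasure μ := by
  obtain ⟨C, hC, h⟩ := IsFrequencyMeasure.decay (μ := μ) 2 (by norm_num)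
  refine ⟨fun x => ⟨Metric.ball x 1, Metric.ball_mem_nhds x one_pos, ?_⟩⟩
  have h1 : jap 1 ^ (-2 : ℝ) * μ (Metric.ball x 1) ≤ C := by
    rw [← setLIntegral_const]
    refine le_trans ?_ (h x)
    refine le_trans (setLIntegral_mono (by fun_prop) fun y hy => ?_) (setLIntegral_le_lintegral _ _)
    refine ennreal_rpow_le_rpow_of_nonpos (ENNReal.ofReal_le_ofReal (bracket_le_of_abs_le ?_))
      (by norm_num)
    rw [abs_one]
    exact (mem_ball_iff_norm.mp hy).le
  rw [mul_comm, ← ENNReal.le_div_iff_mul_le (Or.inl (jap_rpow_ne_zero _ _))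
    (Or.inl (jap_rpow_ne_top _ _))] at h1
  exact h1.trans_lt (ENNReal.div_lt_top hC (jap_rpow_ne_zero _ _))

/-- The reflections `q ↦ -a - q` of the frequency plane preserve `μ(dξ) dτ`. -/
theorem measurePreserving_reflect [IsFrequencyMeasure μ] :
    ∀ᵐ a ∂μ.prod volume,
      MeasurePreserving (fun q : ℝ × ℝ => -a - q) (μ.prod volume) (μ.prod volume) := by
  have h : ∀ᵐ a ∂μ.prod (volume : Measure ℝ), MeasurePreserving (fun x => -a.1 - x) μ μ :=
    Measure.quasiMeasurePreserving_fst.ae IsFrequencyMeasure.reflect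
  filter_upwards [h] with a ha
  exact ha.prod (Measure.measurePreserving_sub_left volume (-a.2))

/-- The change of variables `(q, Q) ↦ (q, -q - Q)` for pairs of frequencies. -/
theorem measurePreserving_shear [IsFrequencyMeasure μ] :
    MeasurePreserving (fun z : (ℝ × ℝ) × (ℝ × ℝ) => (z.1, -z.1 - z.2))
      ((μ.prod volume).prod (μ.prod volume)) ((μ.prod volume).prod (μ.prod volume)) :=
  (MeasurePreserving.id _).skew_product (g := fun a q : ℝ × ℝ => -a - q) (by fun_prop)
    (measurePreserving_reflect.mono fun _ h => h.map_eq)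

/-! ### The resonance kernel -/

/-- Since `⟨x + y⟩` is at most twice the larger bracket, the factor with this bracket can give up
the power `α` to `x + y`; the remaining decay is put on the factor with the smaller bracket. -/
theorem jap_add_rpow_le (x y : ℝ) {α p q : ℝ} (hα : 0 ≤ α) (hp : α ≤ p) (hq : α ≤ q) :
    jap x ^ (-p) * jap y ^ (-q) ≤
      2 ^ α * jap (x + y) ^ (-α) * (jap x ^ (-(p + q - α)) + jap y ^ (-(p + q - α))) := by
  wlog hxy : |y| ≤ |x| generalizing x y p q
  · have := this y x hq hp (le_of_not_ge hxy)
    rw [add_comm y x, add_comm q p] at this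
    rw [mul_comm, add_comm (jap x ^ _)]
    exact this
  have h1 : jap (x + y) ≤ 2 * jap x := by
    have h2 : bracket (x + y) ≤ 2 * bracket x := by
      refine abs_le_of_sq_le_sq' ?_ (by have := bracket_pos x; positivity) |>.2
      rw [mul_pow, bracket_sq, bracket_sq]
      nlinarith [sq_le_sq.mpr hxy, sq_nonneg (x - y)]
    calc jap (x + y) ≤ ENNReal.ofReal (2 * bracket x) := ENNReal.ofReal_le_ofReal h2
      _ = _ := by rw [ENNReal.ofReal_mul (by norm_num), jap]; simp
  have h3 : jap x ^ (-α) ≤ 2 ^ α * jap (x + y) ^ (-α) := by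
    calc jap x ^ (-α) = 2 ^ α * (2 * jap x) ^ (-α) := by
          rw [ENNReal.mul_rpow_of_ne_zero (by norm_num) (jap_ne_zero _), ← mul_assoc,
            ← ENNReal.rpow_add _ _ (by norm_num) (by norm_num), add_neg_cancel, ENNReal.rpow_zero,
            one_mul]
      _ ≤ _ := by
          refine mul_le_mul_right ?_ _
          exact ennreal_rpow_le_rpow_of_nonpos h1 (by linarith)
  have h4 : jap y ≤ jap x := ENNReal.ofReal_le_ofReal (bracket_le_of_abs_le hxy)
  calc jap x ^ (-p) * jap y ^ (-q) = jap x ^ (-α) * (jap x ^ (-(p - α)) * jap y ^ (-q)) := by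
        rw [← mul_assoc, ← jap_rpow_add]
        congr 3
        ring
    _ ≤ (2 ^ α * jap (x + y) ^ (-α)) * (jap y ^ (-(p - α)) * jap y ^ (-q)) := by
        gcongr ?_ * (?_ * _)
        exact ennreal_rpow_le_rpow_of_nonpos h4 (by linarith)
    _ = (2 ^ α * jap (x + y) ^ (-α)) * jap y ^ (-(p + q - α)) := by
        rw [← jap_rpow_add]
        congr 3
        ring
    _ ≤ _ := by
        gcongr
        exact le_add_self

/-- A quadratic polynomial `2y² + A` without linear term is, on the scale of brackets, at least as
large as the square of the distance of `y` to the nearer of its two (real) zeros `±r`. -/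
theorem exists_jap_quadratic_le (A : ℝ) : ∃ r : ℝ, ∀ (y : ℝ) {α : ℝ}, 0 ≤ α →
    jap (2 * y ^ 2 + A) ^ (-α) ≤
      2 ^ α * (jap (y - r) ^ (-(2 * α)) + jap (y + r) ^ (-(2 * α))) := by
  have key : ∀ (v w : ℝ), w ^ 2 ≤ |v| → ∀ {α : ℝ}, 0 ≤ α →
      jap v ^ (-α) ≤ 2 ^ α * jap w ^ (-(2 * α)) := by
    intro v w hvw α hα
    have h1 : bracket w ^ (2 : ℝ) ≤ 2 * bracket v := by
      rw [Real.rpow_two, bracket_sq]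
      linarith [one_add_abs_le_bracket v]
    have h2 : jap w ^ (2 : ℝ) ≤ 2 * jap v := by
      rw [jap_rpow]
      refine (ENNReal.ofReal_le_ofReal h1).trans_eq ?_
      rw [ENNReal.ofReal_mul (by norm_num), jap]
      simp
    calc jap v ^ (-α) = 2 ^ α * (2 * jap v) ^ (-α) := by
          rw [ENNReal.mul_rpow_of_ne_zero (by norm_num) (jap_ne_zero _), ← mul_assoc,
            ← ENNReal.rpow_add _ _ (by norm_num) (by norm_num), add_neg_cancel, ENNReal.rpow_zero,
            one_mul]
      _ ≤ 2 ^ α * (jap w ^ (2 : ℝ)) ^ (-α) := by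
          refine mul_le_mul_right ?_ _
          exact ennreal_rpow_le_rpow_of_nonpos h2 (by linarith)
      _ = _ := by
          rw [← ENNReal.rpow_mul]
          congr 2
          ring
  rcases le_total 0 A with hA | hA
  · refine ⟨0, fun y α hα => (key _ (y - 0) ?_ hα).trans ?_⟩
    · rw [abs_of_nonneg (by positivity)]
      nlinarith [sq_nonneg y]
    · gcongr
      exact le_self_add
  · refine ⟨Real.sqrt (-A / 2), fun y α hα => ?_⟩
    set r := Real.sqrt (-A / 2) with hr
    have hA' : A = -(2 * r ^ 2) := by
      rw [hr, Real.sq_sqrt (by linarith)]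
      ring
    have hfac : 2 * y ^ 2 + A = 2 * ((y - r) * (y + r)) := by
      rw [hA']
      ring
    rcases le_total |y - r| |y + r| with h | h
    · refine (key _ (y - r) ?_ hα).trans ?_
      · rw [hfac, abs_mul, abs_mul, abs_two, ← sq_abs]
        nlinarith [abs_nonneg (y - r), abs_nonneg (y + r)]
      · gcongr
        exact le_self_add
    · refine (key _ (y + r) ?_ hα).trans ?_
      · rw [hfac, abs_mul, abs_mul, abs_two, ← sq_abs]
        nlinarith [abs_nonneg (y - r), abs_nonneg (y + r)]
      · gcongr
        exact le_add_self

/-- The modulation `τ + ξ²` of a frequency `(ξ, τ)`. -/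
def modulation (q : ℝ × ℝ) : ℝ := q.2 + q.1 ^ 2

@[fun_prop]
theorem continuous_modulation : Continuous modulation := by
  unfold modulation
  fun_prop

@[fun_prop]
theorem measurable_modulation : Measurable modulation := continuous_modulation.measurable

/-- The kernel bound behind the bilinear estimates: integration in `τ` leaves a negative power of a
quadratic polynomial in `ξ`, with an exponent larger than `1 / 2`. -/
theorem exists_kernel_bound (μ : Measure ℝ) [IsFrequencyMeasure μ] {p q : ℝ} (hp : p ≤ 1)
    (hq : q ≤ 1) (hpq : 3 / 2 < p + q) : ∃ C : ℝ≥0∞, C ≠ ⊤ ∧ ∀ a : ℝ × ℝ,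
      ∫⁻ z, jap (modulation (-a - z)) ^ (-p) * jap (modulation z) ^ (-q) ∂μ.prod volume ≤ C := by
  obtain ⟨α, hα, hα'⟩ := exists_between (show (1 / 2 : ℝ) < p + q - 1 by linarith)
  obtain ⟨D, hD, hdecay⟩ := IsFrequencyMeasure.decay (μ := μ) (2 * α) (by linarith)
  have hγ : 1 < p + q - α := by linarith
  set γ := p + q - α with hγdef
  set I : ℝ≥0∞ := ∫⁻ x, jap x ^ (-γ) with hI
  have hItop : I ≠ ⊤ := (lintegral_jap_lt_top hγ).ne
  refine ⟨2 ^ α * (2 ^ α * (D + D)) * (I + I), by finiteness, fun a => ?_⟩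
  rw [lintegral_prod _ (by fun_prop)]
  obtain ⟨r, hr⟩ := exists_jap_quadratic_le (a.1 ^ 2 / 2 - a.2)
  have hinner : ∀ x : ℝ, ∫⁻ y, jap (modulation (-a - (x, y))) ^ (-p) *
      jap (modulation (x, y)) ^ (-q) ≤
      2 ^ α * (2 ^ α * (jap (x + a.1 / 2 - r) ^ (-(2 * α)) + jap (x + a.1 / 2 + r) ^ (-(2 * α)))) *
        (I + I) := by
    intro x
    have hsum : ∀ y : ℝ, modulation (-a - (x, y)) + modulation (x, y) =
        2 * (x + a.1 / 2) ^ 2 + (a.1 ^ 2 / 2 - a.2) := by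
      intro y
      simp only [modulation, Prod.fst_sub, Prod.snd_sub, Prod.fst_neg, Prod.snd_neg]
      ring
    have h1 : ∀ y : ℝ, jap (modulation (-a - (x, y))) ^ (-p) * jap (modulation (x, y)) ^ (-q) ≤
        2 ^ α * jap (2 * (x + a.1 / 2) ^ 2 + (a.1 ^ 2 / 2 - a.2)) ^ (-α) *
          (jap (modulation (-a - (x, y))) ^ (-γ) + jap (modulation (x, y)) ^ (-γ)) := by
      intro y
      rw [← hsum y]
      exact jap_add_rpow_le _ _ (by linarith) (by linarith) (by linarith)
    refine (lintegral_mono h1).trans ?_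
    rw [lintegral_const_mul _ (by fun_prop), lintegral_add_left (by fun_prop)]
    have h2 : ∫⁻ y, jap (modulation (x, y)) ^ (-γ) = I :=
      lintegral_add_right_eq_self (fun y => jap y ^ (-γ)) (x ^ 2)
    have h3 : ∫⁻ y, jap (modulation (-a - (x, y))) ^ (-γ) = I := by
      rw [hI, ← lintegral_sub_left_eq_self (fun y => jap y ^ (-γ)) (-a.2 + (-a.1 - x) ^ 2)]
      refine lintegral_congr fun y => ?_
      congr 2
      simp only [modulation, Prod.fst_sub, Prod.snd_sub, Prod.fst_neg, Prod.snd_neg]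
      ring
    rw [h2, h3]
    gcongr
    exact hr _ (by linarith)
  refine (lintegral_mono hinner).trans ?_
  rw [lintegral_mul_const _ (by fun_prop), lintegral_const_mul _ (by fun_prop),
    lintegral_const_mul _ (by fun_prop), lintegral_add_left (by fun_prop)]
  gcongr
  · refine le_trans (le_of_eq ?_) (hdecay (r - a.1 / 2))
    refine lintegral_congr fun x => ?_
    congr 2
    ring
  · refine le_trans (le_of_eq ?_) (hdecay (-r - a.1 / 2))
    refine lintegral_congr fun x => ?_
    congr 2
    ring

end

/-! ### Bilinear estimates on the frequency side -/

section

theorem sq_lintegral_mul_le {α : Type*} [MeasurableSpace α] (ν : Measure α) {f g : α → ℝ≥0∞}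
    (hf : Measurable f) (hg : Measurable g) :
    (∫⁻ x, f x * g x ∂ν) ^ 2 ≤ (∫⁻ x, f x ^ 2 ∂ν) * ∫⁻ x, g x ^ 2 ∂ν := by
  have h := ENNReal.lintegral_mul_le_Lp_mul_Lq ν Real.HolderConjugate.two_two hf.aemeasurable
    hg.aemeasurable
  simp only [Pi.mul_apply, ENNReal.rpow_two] at h
  refine (pow_le_pow_left' h 2).trans_eq ?_
  rw [mul_pow]
  congr 1 <;>
  · rw [← ENNReal.rpow_two, ← ENNReal.rpow_mul]
    norm_num

theorem add_three_sq_le (a b c : ℝ≥0∞) : (a + b + c) ^ 2 ≤ 3 * (a ^ 2 + b ^ 2 + c ^ 2) := by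
  by_cases h : a = ⊤ ∨ b = ⊤ ∨ c = ⊤
  · rcases h with rfl | rfl | rfl <;> simp
  · push Not at h
    obtain ⟨ha, hb, hc⟩ := h
    lift a to NNReal using ha
    lift b to NNReal using hb
    lift c to NNReal using hc
    norm_cast
    rw [← NNReal.coe_le_coe]
    push_cast
    nlinarith [sq_nonneg (a - b : ℝ), sq_nonneg (b - c : ℝ), sq_nonneg (a - c : ℝ)]

variable {μ : Measure ℝ} {f g : ℝ × ℝ → ℝ≥0∞} {p q : ℝ}

/-- The convolution `∫ f(q₁) g(q₂)` over all pairs of frequencies with `Q + q₁ + q₂ = 0`. -/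
def crossConv (μ : Measure ℝ) (f g : ℝ × ℝ → ℝ≥0∞) (Q : ℝ × ℝ) : ℝ≥0∞ :=
  ∫⁻ z, f (-Q - z) * g z ∂μ.prod volume

theorem measurable_crossConv [SFinite μ] (hf : Measurable f) (hg : Measurable g) :
    Measurable (crossConv μ f g) :=
  Measurable.lintegral_prod_right' (f := fun z : (ℝ × ℝ) × (ℝ × ℝ) => f (-z.1 - z.2) * g z.2)
    (by fun_prop)

theorem crossConv_comm [IsFrequencyMeasure μ] (hf : Measurable f) (hg : Measurable g) :
    ∀ᵐ Q ∂μ.prod volume, crossConv μ f g Q = crossConv μ g f Q := by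
  filter_upwards [measurePreserving_reflect (μ := μ)] with Q hQ
  rw [crossConv, ← hQ.lintegral_comp (by fun_prop)]
  refine lintegral_congr fun z => ?_
  rw [sub_sub_cancel, mul_comm]

/-- `L²` bound for the convolution, with both factors weighted: Cauchy's inequality for fixed `Q`
against the kernel `⟨m(-Q - z)⟩^{-p} ⟨m(z)⟩^{-q}`, then integration in `Q`. -/
theorem exists_crossConv_bound (μ : Measure ℝ) [IsFrequencyMeasure μ] (hp : p ≤ 1) (hq : q ≤ 1)
    (hpq : 3 / 2 < p + q) :
    ∃ C : ℝ≥0∞, C ≠ ⊤ ∧ ∀ f g : ℝ × ℝ → ℝ≥0∞, Measurable f → Measurable g →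
      ∫⁻ Q, crossConv μ f g Q ^ 2 ∂μ.prod volume ≤
        C * ((∫⁻ z, jap (modulation z) ^ p * f z ^ 2 ∂μ.prod volume) *
          ∫⁻ z, jap (modulation z) ^ q * g z ^ 2 ∂μ.prod volume) := by
  obtain ⟨C, hC, hker⟩ := exists_kernel_bound μ hp hq hpq
  refine ⟨C, hC, fun f g hf hg => ?_⟩
  have hpt : ∀ Q, crossConv μ f g Q ^ 2 ≤
      C * ∫⁻ z, (jap (modulation (-Q - z)) ^ p * f (-Q - z) ^ 2) *
        (jap (modulation z) ^ q * g z ^ 2) ∂μ.prod volume := by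
    intro Q
    have h1 : crossConv μ f g Q = ∫⁻ z,
        (jap (modulation (-Q - z)) ^ (-(p / 2)) * jap (modulation z) ^ (-(q / 2))) *
        ((jap (modulation (-Q - z)) ^ (p / 2) * f (-Q - z)) *
          (jap (modulation z) ^ (q / 2) * g z)) ∂μ.prod volume := by
      refine lintegral_congr fun z => ?_
      have e1 := jap_rpow_mul_neg (modulation (-Q - z)) (p / 2)
      have e2 := jap_rpow_mul_neg (modulation z) (q / 2)
      calc f (-Q - z) * g z = (jap (modulation (-Q - z)) ^ (p / 2) *
            jap (modulation (-Q - z)) ^ (-(p / 2))) * (jap (modulation z) ^ (q / 2) *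
            jap (modulation z) ^ (-(q / 2))) * (f (-Q - z) * g z) := by
            rw [e1, e2, one_mul, one_mul]
        _ = _ := by ring
    rw [h1]
    refine (sq_lintegral_mul_le _ (by fun_prop) (by fun_prop)).trans ?_
    simp only [mul_pow, jap_rpow_sq]
    refine mul_le_mul' ?_ (le_of_eq ?_)
    · refine le_trans (le_of_eq ?_) (hker Q)
      refine lintegral_congr fun z => ?_
      congr 2 <;> ring
    · refine lintegral_congr fun z => ?_
      rw [mul_div_cancel₀ p two_ne_zero, mul_div_cancel₀ q two_ne_zero]
  refine (lintegral_mono hpt).trans ?_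
  rw [lintegral_const_mul _ (by
    exact Measurable.lintegral_prod_right' (f := fun z : (ℝ × ℝ) × (ℝ × ℝ) =>
      (jap (modulation (-z.1 - z.2)) ^ p * f (-z.1 - z.2) ^ 2) *
        (jap (modulation z.2) ^ q * g z.2 ^ 2)) (by fun_prop))]
  gcongr
  rw [lintegral_lintegral_swap (by fun_prop), ← lintegral_const_mul _ (by fun_prop)]
  refine (lintegral_congr_ae ?_).le
  filter_upwards [measurePreserving_reflect (μ := μ)] with z hz
  rw [lintegral_mul_const _ (by fun_prop),
    ← hz.lintegral_comp (f := fun w => jap (modulation w) ^ p * f w ^ 2) (by fun_prop)]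
  congr 1
  refine lintegral_congr fun Q => ?_
  rw [neg_sub_comm]

/-- `L²` bound for the convolution with a negative weight on the output and no weight on `f`. It
rests on the same kernel bound, with the roles of `Q` and of the frequency of `f` interchanged in
Cauchy's inequality. -/
theorem exists_weighted_crossConv_bound (μ : Measure ℝ) [IsFrequencyMeasure μ] (hp : p ≤ 1)
    (hq : q ≤ 1) (hpq : 3 / 2 < p + q) :
    ∃ C : ℝ≥0∞, C ≠ ⊤ ∧ ∀ f g : ℝ × ℝ → ℝ≥0∞, Measurable f → Measurable g →
      ∫⁻ Q, jap (modulation Q) ^ (-p) * crossConv μ f g Q ^ 2 ∂μ.prod volume ≤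
        C * ((∫⁻ z, f z ^ 2 ∂μ.prod volume) *
          ∫⁻ z, jap (modulation z) ^ q * g z ^ 2 ∂μ.prod volume) := by
  obtain ⟨C, hC, hker⟩ := exists_kernel_bound μ hq hp (by linarith)
  refine ⟨C, hC, fun f g hf hg => ?_⟩
  set B := ∫⁻ z, jap (modulation z) ^ q * g z ^ 2 ∂μ.prod volume with hB
  have hpt : ∀ᵐ Q ∂μ.prod volume, jap (modulation Q) ^ (-p) * crossConv μ f g Q ^ 2 ≤
      (∫⁻ w, f w ^ 2 * (jap (modulation (-w - Q)) ^ (-q) * jap (modulation Q) ^ (-p))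
        ∂μ.prod volume) * B := by
    filter_upwards [measurePreserving_reflect (μ := μ)] with Q hQ
    have h1 : crossConv μ f g Q = ∫⁻ z, (f (-Q - z) * jap (modulation z) ^ (-(q / 2))) *
        (jap (modulation z) ^ (q / 2) * g z) ∂μ.prod volume := by
      refine lintegral_congr fun z => ?_
      have e2 := jap_rpow_mul_neg (modulation z) (q / 2)
      calc f (-Q - z) * g z = f (-Q - z) * g z * (jap (modulation z) ^ (q / 2) *
            jap (modulation z) ^ (-(q / 2))) := by rw [e2, mul_one]
        _ = _ := by ring
    have h2 : crossConv μ f g Q ^ 2 ≤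
        (∫⁻ z, f (-Q - z) ^ 2 * jap (modulation z) ^ (-q) ∂μ.prod volume) * B := by
      rw [h1]
      refine (sq_lintegral_mul_le _ (by fun_prop) (by fun_prop)).trans_eq ?_
      simp only [mul_pow, jap_rpow_sq, mul_neg, mul_div_cancel₀ q two_ne_zero, hB]
    refine (mul_le_mul_right h2 _).trans_eq ?_
    rw [← mul_assoc]
    congr 1
    rw [← hQ.lintegral_comp (f := fun w => f w ^ 2 * (jap (modulation (-w - Q)) ^ (-q) *
      jap (modulation Q) ^ (-p))) (by fun_prop), ← lintegral_const_mul _ (by fun_prop)]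
    refine lintegral_congr fun z => ?_
    rw [show -(-Q - z) - Q = z by abel]
    ring
  refine (lintegral_mono_ae hpt).trans ?_
  rw [lintegral_mul_const _ (by
    exact Measurable.lintegral_prod_right' (f := fun z : (ℝ × ℝ) × (ℝ × ℝ) =>
      f z.2 ^ 2 * (jap (modulation (-z.2 - z.1)) ^ (-q) * jap (modulation z.1) ^ (-p)))
        (by fun_prop)), ← mul_assoc]
  gcongr
  rw [lintegral_lintegral_swap (by fun_prop), ← lintegral_const_mul _ (by fun_prop)]
  refine lintegral_mono fun w => ?_
  dsimp only
  rw [lintegral_const_mul _ (by fun_prop), mul_comm]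
  gcongr
  exact hker w

/-! ### The resonance relation -/

/-- If `Q + q₁ + q₂ = 0`, the three modulations add up to the sum of the squares of the spatial
frequencies, so that one of them is at least of the order `⟨ξ⟩²`. This pays for the derivative. -/
theorem sq_bracket_le_of_add_eq_zero {Q q₁ q₂ : ℝ × ℝ} (h : Q + q₁ + q₂ = 0) :
    bracket Q.1 ^ 2 ≤ 6 * bracket (modulation Q) ∨ bracket Q.1 ^ 2 ≤ 6 * bracket (modulation q₁) ∨
      bracket Q.1 ^ 2 ≤ 6 * bracket (modulation q₂) := by
  by_contra! hcon
  obtain ⟨h0, h1, h2⟩ := hcon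
  have h3 : modulation Q + modulation q₁ + modulation q₂ = Q.1 ^ 2 + q₁.1 ^ 2 + q₂.1 ^ 2 := by
    have h4 : Q.2 + q₁.2 + q₂.2 = 0 := congrArg Prod.snd h
    simp only [modulation]
    linarith
  have h4 := bracket_sq Q.1
  have e0 := (le_abs_self _).trans (abs_le_bracket (modulation Q))
  have e1 := (le_abs_self _).trans (abs_le_bracket (modulation q₁))
  have e2 := (le_abs_self _).trans (abs_le_bracket (modulation q₂))
  nlinarith [one_le_bracket (modulation Q), sq_nonneg q₁.1, sq_nonneg q₂.1]

theorem jap_le_sqrt_of_sq_bracket_le {x y : ℝ} (h : bracket x ^ 2 ≤ 6 * bracket y) :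
    jap x ≤ 3 * jap y ^ (1 / 2 : ℝ) := by
  have h1 : bracket x ≤ 3 * bracket y ^ (1 / 2 : ℝ) := by
    have hy := bracket_pos y
    refine abs_le_of_sq_le_sq' ?_ (by positivity) |>.2
    rw [mul_pow, ← Real.rpow_natCast (bracket y ^ (1 / 2 : ℝ)), ← Real.rpow_mul hy.le]
    norm_num
    linarith
  rw [jap_rpow, jap]
  refine (ENNReal.ofReal_le_ofReal h1).trans_eq ?_
  rw [ENNReal.ofReal_mul (by norm_num)]
  simp

theorem jap_add_le (x y : ℝ) : jap (x + y) ≤ 2 * (jap x * jap y) := by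
  refine (ENNReal.ofReal_le_ofReal (bracket_add_le x y)).trans_eq ?_
  rw [ENNReal.ofReal_mul (by norm_num), ENNReal.ofReal_mul (bracket_pos x).le]
  simp [jap]

/-- The region where the output modulation dominates. -/
def outputRegion : Set (ℝ × ℝ) := {Q | bracket Q.1 ^ 2 ≤ 6 * bracket (modulation Q)}

theorem measurableSet_outputRegion : MeasurableSet outputRegion := by
  have := continuous_bracket.measurable
  exact measurableSet_le (by fun_prop) (by fun_prop)

/-- Multiplication by `⟨ξ⟩^s`. -/
def freqWeight (s : ℝ) (F : ℝ × ℝ → ℝ≥0∞) (q : ℝ × ℝ) : ℝ≥0∞ := jap q.1 ^ s * F q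

/-- Multiplication by `⟨τ + ξ²⟩^{1/2}`. -/
def modWeight (F : ℝ × ℝ → ℝ≥0∞) (q : ℝ × ℝ) : ℝ≥0∞ := jap (modulation q) ^ (1 / 2 : ℝ) * F q

@[fun_prop]
theorem measurable_freqWeight (s : ℝ) {F : ℝ × ℝ → ℝ≥0∞} (hF : Measurable F) :
    Measurable (freqWeight s F) := by
  unfold freqWeight
  fun_prop

@[fun_prop]
theorem measurable_modWeight {F : ℝ × ℝ → ℝ≥0∞} (hF : Measurable F) :
    Measurable (modWeight F) := by
  unfold modWeight
  fun_prop

theorem modWeight_sq (F : ℝ × ℝ → ℝ≥0∞) (q : ℝ × ℝ) :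
    modWeight F q ^ 2 = jap (modulation q) ^ (1 : ℝ) * F q ^ 2 := by
  rw [modWeight, mul_pow, jap_rpow_sq]
  norm_num

/-- The derivative and the weight `⟨ξ⟩^s` are distributed over the two factors; which of the three
terms takes the derivative depends on the largest modulation. -/
theorem crossConv_weight_le [SFinite μ] {s : ℝ} (hs : 0 ≤ s) {F₁ F₂ : ℝ × ℝ → ℝ≥0∞}
    (h₁ : Measurable F₁) (h₂ : Measurable F₂) (Q : ℝ × ℝ) :
    jap Q.1 ^ s * (jap Q.1 * crossConv μ F₁ F₂ Q) ≤
      3 * 2 ^ s * (outputRegion.indicator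
          (fun Q => jap Q.1 * crossConv μ (freqWeight s F₁) (freqWeight s F₂) Q) Q +
        crossConv μ (modWeight (freqWeight s F₁)) (freqWeight s F₂) Q +
        crossConv μ (freqWeight s F₁) (modWeight (freqWeight s F₂)) Q) := by
  have hm1 := measurable_freqWeight s h₁
  have hm2 := measurable_freqWeight s h₂
  have hind : outputRegion.indicator
      (fun Q => jap Q.1 * crossConv μ (freqWeight s F₁) (freqWeight s F₂) Q) Q =
      ∫⁻ z, outputRegion.indicator (fun Q => jap Q.1) Q *
        (freqWeight s F₁ (-Q - z) * freqWeight s F₂ z) ∂μ.prod volume := by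
    rw [lintegral_const_mul _ (by fun_prop)]
    by_cases hQ : Q ∈ outputRegion <;> simp [hQ, crossConv]
  rw [hind]
  simp only [crossConv]
  rw [← lintegral_const_mul _ (by fun_prop), ← lintegral_const_mul _ (by fun_prop),
    ← lintegral_add_left (by fun_prop), ← lintegral_add_left (by fun_prop),
    ← lintegral_const_mul _ (by fun_prop)]
  refine lintegral_mono fun z => ?_
  have hsplit : jap Q.1 ^ s ≤ 2 ^ s * (jap (-Q - z).1 ^ s * jap z.1 ^ s) := by
    rw [← ENNReal.mul_rpow_of_nonneg _ _ hs, ← ENNReal.mul_rpow_of_nonneg _ _ hs]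
    refine ENNReal.rpow_le_rpow ?_ hs
    refine le_trans (le_of_eq ?_) (jap_add_le _ _)
    rw [← jap_neg]
    congr 1
    simp
  set G₁ := freqWeight s F₁ (-Q - z) with hG₁
  set G₂ := freqWeight s F₂ z with hG₂
  have hG : jap Q.1 ^ s * (F₁ (-Q - z) * F₂ z) ≤ 2 ^ s * (G₁ * G₂) := by
    refine (mul_le_mul_left hsplit _).trans_eq ?_
    simp only [hG₁, hG₂, freqWeight]
    ring
  have hmain : jap Q.1 * (G₁ * G₂) ≤ 3 * (outputRegion.indicator (fun Q => jap Q.1) Q * (G₁ * G₂) +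
      modWeight (freqWeight s F₁) (-Q - z) * G₂ + G₁ * modWeight (freqWeight s F₂) z) := by
    rcases sq_bracket_le_of_add_eq_zero (Q := Q) (q₁ := -Q - z) (q₂ := z) (by abel) with h | h | h
    · have hmem : Q ∈ outputRegion := h
      rw [Set.indicator_of_mem hmem, add_assoc, mul_add]
      refine le_trans ?_ le_self_add
      exact le_mul_of_one_le_left' (by norm_num)
    · rw [add_right_comm]
      refine le_trans ?_ (mul_le_mul_right le_add_self _)
      refine (mul_le_mul_left (jap_le_sqrt_of_sq_bracket_le h) _).trans_eq ?_
      simp only [modWeight, hG₁]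
      ring
    · refine le_trans ?_ (mul_le_mul_right le_add_self _)
      refine (mul_le_mul_left (jap_le_sqrt_of_sq_bracket_le h) _).trans_eq ?_
      simp only [modWeight, hG₂]
      ring
  calc jap Q.1 ^ s * (jap Q.1 * (F₁ (-Q - z) * F₂ z))
      = jap Q.1 * (jap Q.1 ^ s * (F₁ (-Q - z) * F₂ z)) := by ring
    _ ≤ jap Q.1 * (2 ^ s * (G₁ * G₂)) := by gcongr
    _ = 2 ^ s * (jap Q.1 * (G₁ * G₂)) := by ring
    _ ≤ 2 ^ s * (3 * (outputRegion.indicator (fun Q => jap Q.1) Q * (G₁ * G₂) +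
      modWeight (freqWeight s F₁) (-Q - z) * G₂ + G₁ * modWeight (freqWeight s F₂) z)) := by gcongr
    _ = _ := by ring

/-- In the region where the output modulation dominates, the weight `⟨ξ⟩² ⟨τ + ξ²⟩⁻²` is
integrable in `τ`, uniformly in `ξ`: there Cauchy's inequality loses nothing. -/
theorem exists_lintegral_outputRegion_le : ∃ C : ℝ≥0∞, C ≠ ⊤ ∧ ∀ ξ : ℝ,
    ∫⁻ τ, (outputRegion.indicator (fun Q => jap Q.1 * jap (modulation Q) ^ (-1 : ℝ)) (ξ, τ)) ^ 2
      ≤ C := by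
  refine ⟨ENNReal.ofReal (72 * Real.pi), ENNReal.ofReal_ne_top, fun ξ => ?_⟩
  set M := bracket ξ ^ 2 with hM
  have hMpos : 0 < M := by
    have := bracket_pos ξ
    positivity
  have hpt : ∀ τ : ℝ,
      (outputRegion.indicator (fun Q => jap Q.1 * jap (modulation Q) ^ (-1 : ℝ)) (ξ, τ)) ^ 2 ≤
        ENNReal.ofReal (72 * M⁻¹ * (1 + ((τ + ξ ^ 2) / M) ^ 2)⁻¹) := by
    intro τ
    by_cases h : (ξ, τ) ∈ outputRegion
    · have h' : M ≤ 6 * bracket (τ + ξ ^ 2) := h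
      rw [Set.indicator_of_mem h, jap_rpow, jap, ← ENNReal.ofReal_mul (bracket_pos _).le,
        ← ENNReal.ofReal_pow (by
          have h1 := bracket_pos ξ
          have h2 := bracket_pos (modulation (ξ, τ))
          positivity)]
      refine ENNReal.ofReal_le_ofReal ?_
      have h3 : modulation (ξ, τ) = τ + ξ ^ 2 := rfl
      rw [mul_pow, h3, Real.rpow_neg_one, inv_pow]
      change M * _ ≤ _
      set m := τ + ξ ^ 2
      have hb := bracket_sq m
      have hbp := bracket_pos m
      have h4 : (bracket m ^ 2)⁻¹ ≤ 72 * (M ^ 2 + m ^ 2)⁻¹ := by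
        rw [← div_eq_mul_inv, inv_le_comm₀ (by positivity) (by positivity), inv_div,
          div_le_iff₀ (by positivity)]
        nlinarith
      calc M * (bracket m ^ 2)⁻¹ ≤ M * (72 * (M ^ 2 + m ^ 2)⁻¹) := by gcongr
        _ = _ := by field_simp
    · rw [Set.indicator_of_notMem h]
      simp
  refine (lintegral_mono hpt).trans_eq ?_
  have hint : Integrable (fun x : ℝ => (1 + (x / M) ^ 2)⁻¹) :=
    integrable_inv_one_add_sq.comp_div hMpos.ne'
  have hint' : Integrable (fun τ : ℝ => 72 * M⁻¹ * (1 + ((τ + ξ ^ 2) / M) ^ 2)⁻¹) :=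
    (hint.comp_add_right (ξ ^ 2)).const_mul _
  rw [← ofReal_integral_eq_lintegral_ofReal hint'
    (Filter.Eventually.of_forall fun τ => by positivity), integral_const_mul,
    integral_add_right_eq_self (fun x : ℝ => (1 + (x / M) ^ 2)⁻¹) (ξ ^ 2),
    Measure.integral_comp_div (fun x : ℝ => (1 + x ^ 2)⁻¹) M, integral_univ_inv_one_add_sq,
    abs_of_pos hMpos, smul_eq_mul]
  congr 1
  field_simp

end

/-! ### The bilinear estimate in both norms -/

section

variable {μ : Measure ℝ}

/-- The square of `‖⟨ξ⟩^s ⟨τ + ξ²⟩^{q/2} F‖` in `L²_{ξτ}`. -/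
def energy (μ : Measure ℝ) (s q : ℝ) (F : ℝ × ℝ → ℝ≥0∞) : ℝ≥0∞ :=
  ∫⁻ z, jap (modulation z) ^ q * freqWeight s F z ^ 2 ∂μ.prod volume

theorem energy_mono (s : ℝ) {p q : ℝ} (h : p ≤ q) (F : ℝ × ℝ → ℝ≥0∞) :
    energy μ s p F ≤ energy μ s q F := by
  refine lintegral_mono fun z => ?_
  exact mul_le_mul_left (jap_rpow_le_of_le _ h) _

/-- The bilinear estimate in the two norms, in terms of the absolute values of the Fourier
transforms. One factor is measured with the weight `⟨τ + ξ²⟩^{q/2}` only, where `q > 1 / 2` is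
arbitrary; the difference to the weight `⟨τ + ξ²⟩^{1/2}` is what localization in time exploits. -/
theorem exists_bilinear_bound (μ : Measure ℝ) [IsFrequencyMeasure μ] {q s : ℝ} (hq₀ : 1 / 2 < q)
    (hq₁ : q ≤ 1) (hs : 0 ≤ s) : ∃ C : ℝ≥0∞, C ≠ ⊤ ∧ ∀ F₁ F₂ : ℝ × ℝ → ℝ≥0∞,
      Measurable F₁ → Measurable F₂ →
      ∫⁻ Q, (jap (modulation Q) ^ (-(1 / 2) : ℝ) *
          (jap Q.1 ^ s * (jap Q.1 * crossConv μ F₁ F₂ Q))) ^ 2 ∂μ.prod volume ≤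
        C * (energy μ s 1 F₁ * energy μ s q F₂ + energy μ s 1 F₂ * energy μ s q F₁) ∧
      ∫⁻ ξ, (∫⁻ τ, jap (modulation (ξ, τ)) ^ (-1 : ℝ) *
          (jap ξ ^ s * (jap ξ * crossConv μ F₁ F₂ (ξ, τ)))) ^ 2 ∂μ ≤
        C * (energy μ s 1 F₁ * energy μ s q F₂ + energy μ s 1 F₂ * energy μ s q F₁) := by
  obtain ⟨p, hp₀, hp₁⟩ := exists_between (show 3 / 2 - q < 1 by linarith)
  obtain ⟨C₁, hC₁, hA⟩ := exists_crossConv_bound μ hp₁.le hq₁ (by linarith)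
  obtain ⟨C₂, hC₂, hB⟩ := exists_weighted_crossConv_bound μ hp₁.le hq₁ (by linarith)
  obtain ⟨C₃, hC₃, hreg⟩ := exists_lintegral_outputRegion_le
  set D : ℝ≥0∞ := ∫⁻ x, jap x ^ (-(2 - p)) with hD
  have hDtop : D ≠ ⊤ := (lintegral_jap_lt_top (by linarith)).ne
  have h2s : (2 : ℝ≥0∞) ^ s ≠ ⊤ := ENNReal.rpow_ne_top_of_nonneg hs (by simp)
  set K : ℝ≥0∞ := 3 * 2 ^ s with hK
  have hKtop : K ≠ ⊤ := ENNReal.mul_ne_top (by simp) h2s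
  refine ⟨K ^ 2 * (3 * ((9 + C₃) * C₁ + (1 + D) * C₂)), by finiteness, fun F₁ F₂ h₁ h₂ => ?_⟩
  have hG₁ := measurable_freqWeight s h₁
  have hG₂ := measurable_freqWeight s h₂
  set G₁ := freqWeight s F₁ with hG₁def
  set G₂ := freqWeight s F₂ with hG₂def
  set S := energy μ s 1 F₁ * energy μ s q F₂ + energy μ s 1 F₂ * energy μ s q F₁ with hS
  set A := crossConv μ G₁ G₂ with hAdef
  set B₁ := crossConv μ (modWeight G₁) G₂ with hB₁def
  set B₂ := crossConv μ G₁ (modWeight G₂) with hB₂def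
  have mA : Measurable A := measurable_crossConv hG₁ hG₂
  have mB₁ : Measurable B₁ := measurable_crossConv (measurable_modWeight hG₁) hG₂
  have mB₂ : Measurable B₂ := measurable_crossConv hG₁ (measurable_modWeight hG₂)
  have mR : Measurable fun Q : ℝ × ℝ => outputRegion.indicator (fun Q => jap Q.1 * A Q) Q := by
    refine Measurable.indicator ?_ measurableSet_outputRegion
    have := measurable_jap
    fun_prop
  have bA : ∫⁻ Q, A Q ^ 2 ∂μ.prod volume ≤ C₁ * (energy μ s 1 F₁ * energy μ s q F₂) := by
    refine (hA G₁ G₂ hG₁ hG₂).trans ?_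
    exact mul_le_mul_right (mul_le_mul_left (energy_mono s hp₁.le F₁) _) _
  have bB₁ : ∫⁻ Q, jap (modulation Q) ^ (-p) * B₁ Q ^ 2 ∂μ.prod volume ≤
      C₂ * (energy μ s 1 F₁ * energy μ s q F₂) := by
    refine (hB _ G₂ (measurable_modWeight hG₁) hG₂).trans_eq ?_
    simp only [modWeight_sq]
    rfl
  have bB₂ : ∫⁻ Q, jap (modulation Q) ^ (-p) * B₂ Q ^ 2 ∂μ.prod volume ≤
      C₂ * (energy μ s 1 F₂ * energy μ s q F₁) := by
    have h := hB _ G₁ (measurable_modWeight hG₂) hG₁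
    simp only [modWeight_sq] at h
    refine le_trans (le_of_eq ?_) h
    refine lintegral_congr_ae ?_
    filter_upwards [crossConv_comm (μ := μ) hG₁ (measurable_modWeight hG₂)] with Q hQ
    rw [hB₂def, hQ]
  have bA' : ∫⁻ Q, A Q ^ 2 ∂μ.prod volume ≤ C₁ * S := bA.trans (by gcongr; exact le_self_add)
  have bB : ∫⁻ Q, jap (modulation Q) ^ (-p) * B₁ Q ^ 2 ∂μ.prod volume +
      ∫⁻ Q, jap (modulation Q) ^ (-p) * B₂ Q ^ 2 ∂μ.prod volume ≤ C₂ * S := by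
    rw [hS, mul_add]
    exact add_le_add bB₁ bB₂
  have hpt : ∀ Q, jap Q.1 ^ s * (jap Q.1 * crossConv μ F₁ F₂ Q) ≤
      K * (outputRegion.indicator (fun Q => jap Q.1 * A Q) Q + B₁ Q + B₂ Q) :=
    crossConv_weight_le hs h₁ h₂
  constructor
  · have hsq : ∀ Q, (jap (modulation Q) ^ (-(1 / 2) : ℝ) *
        (jap Q.1 ^ s * (jap Q.1 * crossConv μ F₁ F₂ Q))) ^ 2 ≤
        K ^ 2 * (3 * (9 * A Q ^ 2 + jap (modulation Q) ^ (-p) * B₁ Q ^ 2 +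
          jap (modulation Q) ^ (-p) * B₂ Q ^ 2)) := by
      intro Q
      have e1 : jap (modulation Q) ^ (-1 : ℝ) ≤ jap (modulation Q) ^ (-p) :=
        jap_rpow_le_of_le _ (by linarith)
      have e2 : jap (modulation Q) ^ (-1 : ℝ) *
          outputRegion.indicator (fun Q => jap Q.1 * A Q) Q ^ 2 ≤ 9 * A Q ^ 2 := by
        by_cases hQ : Q ∈ outputRegion
        · rw [Set.indicator_of_mem hQ, mul_pow, ← mul_assoc]
          gcongr
          calc jap (modulation Q) ^ (-1 : ℝ) * jap Q.1 ^ 2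
              ≤ jap (modulation Q) ^ (-1 : ℝ) * (3 * jap (modulation Q) ^ (1 / 2 : ℝ)) ^ 2 := by
                gcongr
                exact jap_le_sqrt_of_sq_bracket_le hQ
            _ = 9 * (jap (modulation Q) ^ (1 : ℝ) * jap (modulation Q) ^ (-1 : ℝ)) := by
                rw [mul_pow, jap_rpow_sq]
                norm_num
                ring
            _ = 9 := by rw [jap_rpow_mul_neg, mul_one]
        · simp [hQ]
      calc _ ≤ (jap (modulation Q) ^ (-(1 / 2) : ℝ) *
            (K * (outputRegion.indicator (fun Q => jap Q.1 * A Q) Q + B₁ Q + B₂ Q))) ^ 2 := by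
            exact pow_le_pow_left' (mul_le_mul_right (hpt Q) _) 2
        _ = jap (modulation Q) ^ (-1 : ℝ) * (K ^ 2 *
            (outputRegion.indicator (fun Q => jap Q.1 * A Q) Q + B₁ Q + B₂ Q) ^ 2) := by
            rw [mul_pow, mul_pow, jap_rpow_sq]
            norm_num
        _ ≤ jap (modulation Q) ^ (-1 : ℝ) * (K ^ 2 *
            (3 * (outputRegion.indicator (fun Q => jap Q.1 * A Q) Q ^ 2 + B₁ Q ^ 2 + B₂ Q ^ 2))) := by
            gcongr
            exact add_three_sq_le _ _ _
        _ = K ^ 2 * (3 * (jap (modulation Q) ^ (-1 : ℝ) *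
            outputRegion.indicator (fun Q => jap Q.1 * A Q) Q ^ 2 +
            jap (modulation Q) ^ (-1 : ℝ) * B₁ Q ^ 2 +
            jap (modulation Q) ^ (-1 : ℝ) * B₂ Q ^ 2)) := by ring
        _ ≤ _ := by gcongr
    refine (lintegral_mono hsq).trans ?_
    rw [lintegral_const_mul _ (by fun_prop), lintegral_const_mul _ (by fun_prop),
      lintegral_add_left (by fun_prop), lintegral_add_left (by fun_prop),
      lintegral_const_mul _ (by fun_prop), add_assoc, mul_assoc, mul_assoc]
    gcongr
    calc _ ≤ 9 * (C₁ * S) + C₂ * S := by gcongr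
      _ = (9 * C₁ + 1 * C₂) * S := by ring
      _ ≤ _ := by
        gcongr
        · exact le_self_add
        · exact le_self_add
  · have hcs : ∀ ξ, ∀ B : ℝ × ℝ → ℝ≥0∞, Measurable B →
        (∫⁻ τ, jap (modulation (ξ, τ)) ^ (-1 : ℝ) * B (ξ, τ)) ^ 2 ≤
          D * ∫⁻ τ, jap (modulation (ξ, τ)) ^ (-p) * B (ξ, τ) ^ 2 := by
      intro ξ B mB
      have e1 : ∀ τ, jap (modulation (ξ, τ)) ^ (-1 : ℝ) * B (ξ, τ) =
          jap (modulation (ξ, τ)) ^ (-(2 - p) / 2) *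
            (jap (modulation (ξ, τ)) ^ (-p / 2) * B (ξ, τ)) := by
        intro τ
        rw [← mul_assoc, ← jap_rpow_add]
        congr 2
        ring
      simp only [e1]
      refine (sq_lintegral_mul_le _ (by fun_prop) (by fun_prop)).trans_eq ?_
      simp only [mul_pow, jap_rpow_sq, mul_div_cancel₀ _ (two_ne_zero (α := ℝ))]
      congr 1
      exact lintegral_add_right_eq_self (fun y => jap y ^ (-(2 - p))) (ξ ^ 2)
    have hcs₀ : ∀ ξ, (∫⁻ τ, jap (modulation (ξ, τ)) ^ (-1 : ℝ) *
        outputRegion.indicator (fun Q => jap Q.1 * A Q) (ξ, τ)) ^ 2 ≤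
          C₃ * ∫⁻ τ, A (ξ, τ) ^ 2 := by
      intro ξ
      have e1 : ∀ τ, jap (modulation (ξ, τ)) ^ (-1 : ℝ) *
          outputRegion.indicator (fun Q => jap Q.1 * A Q) (ξ, τ) =
          outputRegion.indicator (fun Q => jap Q.1 * jap (modulation Q) ^ (-1 : ℝ)) (ξ, τ) *
            A (ξ, τ) := by
        intro τ
        by_cases hQ : (ξ, τ) ∈ outputRegion
        · simp only [Set.indicator_of_mem hQ]
          ring
        · simp [hQ]
      simp only [e1]
      have m1 : Measurable (outputRegion.indicator
          (fun Q : ℝ × ℝ => jap Q.1 * jap (modulation Q) ^ (-1 : ℝ))) := by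
        refine Measurable.indicator ?_ measurableSet_outputRegion
        have := measurable_jap
        fun_prop
      refine (sq_lintegral_mul_le _ (by fun_prop) (by fun_prop)).trans ?_
      gcongr
      exact hreg ξ
    have hsq : ∀ ξ, (∫⁻ τ, jap (modulation (ξ, τ)) ^ (-1 : ℝ) *
        (jap ξ ^ s * (jap ξ * crossConv μ F₁ F₂ (ξ, τ)))) ^ 2 ≤
        K ^ 2 * (3 * (C₃ * (∫⁻ τ, A (ξ, τ) ^ 2) +
          D * (∫⁻ τ, jap (modulation (ξ, τ)) ^ (-p) * B₁ (ξ, τ) ^ 2) +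
          D * ∫⁻ τ, jap (modulation (ξ, τ)) ^ (-p) * B₂ (ξ, τ) ^ 2)) := by
      intro ξ
      have e1 : ∫⁻ τ, jap (modulation (ξ, τ)) ^ (-1 : ℝ) *
          (jap ξ ^ s * (jap ξ * crossConv μ F₁ F₂ (ξ, τ))) ≤
          K * ((∫⁻ τ, jap (modulation (ξ, τ)) ^ (-1 : ℝ) *
            outputRegion.indicator (fun Q => jap Q.1 * A Q) (ξ, τ)) +
            (∫⁻ τ, jap (modulation (ξ, τ)) ^ (-1 : ℝ) * B₁ (ξ, τ)) +
            ∫⁻ τ, jap (modulation (ξ, τ)) ^ (-1 : ℝ) * B₂ (ξ, τ)) := by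
        rw [← lintegral_add_left (by fun_prop), ← lintegral_add_left (by fun_prop),
          ← lintegral_const_mul _ (by fun_prop)]
        refine lintegral_mono fun τ => ?_
        refine (mul_le_mul_right (hpt (ξ, τ)) _).trans_eq ?_
        ring
      refine (pow_le_pow_left' e1 2).trans ?_
      rw [mul_pow]
      refine mul_le_mul_right ((add_three_sq_le _ _ _).trans (mul_le_mul_right ?_ _)) _
      exact add_le_add (add_le_add (hcs₀ ξ) (hcs ξ B₁ mB₁)) (hcs ξ B₂ mB₂)
    have m0 : Measurable fun ξ => ∫⁻ τ, A (ξ, τ) ^ 2 :=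
      Measurable.lintegral_prod_right' (f := fun z : ℝ × ℝ => A z ^ 2) (by fun_prop)
    have m1 : Measurable fun ξ => ∫⁻ τ, jap (modulation (ξ, τ)) ^ (-p) * B₁ (ξ, τ) ^ 2 :=
      Measurable.lintegral_prod_right'
        (f := fun z : ℝ × ℝ => jap (modulation z) ^ (-p) * B₁ z ^ 2) (by fun_prop)
    have m2 : Measurable fun ξ => ∫⁻ τ, jap (modulation (ξ, τ)) ^ (-p) * B₂ (ξ, τ) ^ 2 :=
      Measurable.lintegral_prod_right'
        (f := fun z : ℝ × ℝ => jap (modulation z) ^ (-p) * B₂ z ^ 2) (by fun_prop)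
    refine (lintegral_mono hsq).trans ?_
    rw [lintegral_const_mul _ (by fun_prop), lintegral_const_mul _ (by fun_prop),
      lintegral_add_left (by fun_prop), lintegral_add_left (by fun_prop),
      lintegral_const_mul _ (by fun_prop), lintegral_const_mul _ (by fun_prop),
      lintegral_const_mul _ (by fun_prop),
      ← lintegral_prod (fun z : ℝ × ℝ => A z ^ 2) (by fun_prop),
      ← lintegral_prod (fun z : ℝ × ℝ => jap (modulation z) ^ (-p) * B₁ z ^ 2) (by fun_prop),
      ← lintegral_prod (fun z : ℝ × ℝ => jap (modulation z) ^ (-p) * B₂ z ^ 2) (by fun_prop),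
      add_assoc, ← mul_add, mul_assoc, mul_assoc]
    gcongr
    calc _ ≤ C₃ * (C₁ * S) + D * (C₂ * S) := by gcongr
      _ = (C₃ * C₁ + D * C₂) * S := by ring
      _ ≤ _ := by
        gcongr
        · exact le_add_self
        · exact le_add_self

end

/-! ### Functions of polynomial growth in the mean square sense -/

section

/-- `u` is square integrable against some power of `1 + |(x, t)|`. This covers functions in `L²` of
the plane, and functions that are periodic in `x` and `L²` over one period. -/
def IsTemperedL2 (u : ℝ × ℝ → ℂ) : Prop :=
  ∃ N : ℕ, MemLp (fun p => (((1 + ‖p‖) ^ N)⁻¹ : ℝ) • u p) 2 volume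

theorem memLp_one_add_norm_inv : MemLp (fun p : ℝ × ℝ => (((1 + ‖p‖) ^ 2)⁻¹ : ℝ)) 2 volume := by
  rw [memLp_two_iff_integrable_sq (by
    refine Continuous.aestronglyMeasurable ?_
    refine Continuous.inv₀ (by fun_prop) fun p => by positivity)]
  have h := integrable_one_add_norm (E := ℝ × ℝ) (μ := volume) (r := 4) (by
    simp; norm_num)
  refine h.congr (Filter.Eventually.of_forall fun p => ?_)
  have hp : 0 < 1 + ‖p‖ := by positivity
  dsimp only
  rw [Real.rpow_neg hp.le, inv_pow, ← pow_mul]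
  norm_cast

theorem IsTemperedL2.isTempered {u : ℝ × ℝ → ℂ} (hu : IsTemperedL2 u) : IsTempered u := by
  obtain ⟨N, hN⟩ := hu
  refine ⟨N + 2, ?_⟩
  have h := hN.smul (r := 1) memLp_one_add_norm_inv
  have h' := memLp_one_iff_integrable.mp h
  refine h'.congr (Filter.Eventually.of_forall fun p => ?_)
  simp only [Pi.smul_apply', smul_smul]
  congr 1
  rw [pow_add, mul_inv, mul_comm]

theorem IsTemperedL2.isTempered_conjMul {u₁ u₂ : ℝ × ℝ → ℂ} (h₁ : IsTemperedL2 u₁)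
    (h₂ : IsTemperedL2 u₂) : IsTempered (conjMul u₁ u₂) := by
  obtain ⟨N, hN⟩ := h₁
  obtain ⟨M, hM⟩ := h₂
  refine ⟨N + M, ?_⟩
  have h := memLp_one_iff_integrable.mp (MemLp.mul (r := 1) hN.star hM.star)
  refine h.congr (Filter.Eventually.of_forall fun p => ?_)
  simp only [Pi.mul_apply, Pi.star_apply, conjMul, Complex.real_smul, star_mul', RCLike.star_def,
    Complex.conj_ofReal]
  push_cast
  rw [pow_add, mul_inv]
  ring

/-- Translation is continuous in `L²`. -/
theorem tendsto_lintegral_translate_sub {v : ℝ × ℝ → ℂ} (hv : MemLp v 2 volume) :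
    Filter.Tendsto (fun y : ℝ × ℝ => ∫⁻ x, ‖v (x + y) - v x‖ₑ ^ 2) (nhds 0) (nhds 0) := by
  set V := hv.toLp v with hV
  let F : C((ℝ × ℝ), C(ℝ × ℝ, ℝ × ℝ)) :=
    (ContinuousMap.mk (fun z : (ℝ × ℝ) × (ℝ × ℝ) => z.2 + z.1) (by fun_prop)).curry
  have hF : ∀ y, MeasurePreserving (F y) (volume : Measure (ℝ × ℝ)) volume := fun y =>
    measurePreserving_add_right volume y
  have h1 : Filter.Tendsto (fun y => Lp.compMeasurePreserving (F y) (hF y) V) (nhds 0)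
      (nhds (Lp.compMeasurePreserving (F 0) (hF 0) V)) :=
    Filter.Tendsto.compMeasurePreservingLp tendsto_const_nhds F.continuous.continuousAt hF (hF 0)
      (by simp)
  have h2 := ENNReal.Tendsto.pow (n := 2) (tendsto_iff_edist_tendsto_0.mp h1)
  rw [zero_pow two_ne_zero] at h2
  refine h2.congr fun y => ?_
  have e1 : ∀ y, Lp.compMeasurePreserving (F y) (hF y) V =ᵐ[volume] fun x => v (x + y) := fun y =>
    (Lp.coeFn_compMeasurePreserving V (hF y)).trans
      ((hF y).quasiMeasurePreserving.ae_eq_comp hv.coeFn_toLp)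
  rw [Lp.edist_def, eLpNorm_eq_lintegral_rpow_enorm_toReal (by simp) (by simp)]
  simp only [ENNReal.toReal_ofNat, ENNReal.rpow_two]
  rw [← ENNReal.rpow_natCast, ← ENNReal.rpow_mul,
    show 1 / (2 : ℝ) * ((2 : ℕ) : ℝ) = 1 by norm_num, ENNReal.rpow_one]
  refine lintegral_congr_ae ?_
  filter_upwards [e1 y, e1 0] with x hx hx0
  rw [Pi.sub_apply, hx, hx0, add_zero]

theorem exists_polynomial_bound (κ : 𝓢(ℝ × ℝ, ℂ)) (N : ℕ) :
    ∃ C : ℝ, 0 ≤ C ∧ ∀ p, (1 + ‖p‖) ^ N * ‖κ p‖ ≤ C := by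
  obtain ⟨S, C, hC, hb⟩ := decay_bound N
  exact ⟨C * S.sup (schwartzSeminormFamily ℂ (ℝ × ℝ) ℂ) κ, by positivity, hb κ⟩

variable {u u₁ u₂ : ℝ × ℝ → ℂ} (κ ρ φ : 𝓢(ℝ × ℝ, ℂ))

/-- The correlation `G(y) = ∫ κ(p) ū₂(p) ū₁(p + y) dp` is continuous at `y = 0`. -/
theorem continuousAt_correlation (m₁ : Measurable u₁) (m₂ : Measurable u₂) (h₁ : IsTemperedL2 u₁)
    (h₂ : IsTemperedL2 u₂) :
    ContinuousAt (fun y => ∫ p, κ p * conj (u₂ p) * conj (u₁ (p + y))) 0 := by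
  obtain ⟨N, hN⟩ := h₁
  obtain ⟨M, hM⟩ := h₂
  obtain ⟨C, hC, hb⟩ := exists_polynomial_bound κ (N + M)
  set v : ℝ × ℝ → ℂ := fun p => (((1 + ‖p‖) ^ N)⁻¹ : ℝ) • u₁ p with hv
  set a : ℝ × ℝ → ℂ := fun p => (((1 + ‖p‖) ^ N : ℝ) : ℂ) * (κ p * conj (u₂ p)) with ha
  set m : ℝ × ℝ → ℝ × ℝ → ℝ := fun y p => ((1 + ‖p + y‖) ^ N) / ((1 + ‖p‖) ^ N) with hm
  have mκ : Measurable κ := κ.continuous.measurable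
  have mv : Measurable v := by fun_prop
  have ma : Measurable a := by
    have : Measurable fun z : ℂ => conj z := Complex.continuous_conj.measurable
    fun_prop
  have hsplit : ∀ y p, κ p * conj (u₂ p) * conj (u₁ (p + y)) =
      a p * ((m y p : ℝ) * conj (v (p + y))) := by
    intro y p
    have e1 : ((1 + ‖p‖ : ℝ) : ℂ) ≠ 0 := by
      exact_mod_cast (by positivity : (1 + ‖p‖ : ℝ) ≠ 0)
    have e2 : ((1 + ‖p + y‖ : ℝ) : ℂ) ≠ 0 := by
      exact_mod_cast (by positivity : (1 + ‖p + y‖ : ℝ) ≠ 0)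
    simp only [hv, ha, hm, Complex.real_smul, map_mul, Complex.conj_ofReal]
    push_cast at e1 e2 ⊢
    field_simp
  have aL : MemLp a 2 volume := by
    refine MemLp.of_le_mul (c := C) hM ma.aestronglyMeasurable
      (Filter.Eventually.of_forall fun p => ?_)
    have hp : 0 < 1 + ‖p‖ := by positivity
    rw [ha]
    simp only [norm_mul, norm_smul, Complex.norm_real, RCLike.norm_conj]
    rw [Real.norm_of_nonneg (by positivity), Real.norm_of_nonneg (by positivity)]
    calc (1 + ‖p‖) ^ N * (‖κ p‖ * ‖u₂ p‖)
        = ((1 + ‖p‖) ^ (N + M) * ‖κ p‖) * (((1 + ‖p‖) ^ M)⁻¹ * ‖u₂ p‖) := by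
          rw [pow_add]
          field_simp
      _ ≤ _ := by
          gcongr
          exact hb p
  have hmb : ∀ y, ‖y‖ ≤ 1 → ∀ p, m y p ≤ 2 ^ N := by
    intro y hy p
    rw [hm]
    dsimp only
    rw [div_le_iff₀ (by positivity), ← mul_pow]
    gcongr
    linarith [norm_add_le p y, norm_nonneg p]
  have hm0 : ∀ y p, 0 ≤ m y p := fun y p => by positivity
  have mm : ∀ y, Measurable (m y) := fun y => by
    simp only [hm]
    fun_prop
  have hmc : ∀ p, Continuous fun y => m y p := fun p => by
    simp only [hm]
    fun_prop
  have hm1 : ∀ p, m 0 p = 1 := fun p => by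
    simp only [hm, add_zero]
    exact div_self (by positivity)
  clear_value a v m
  have hev : ∀ᶠ y : ℝ × ℝ in nhds 0, ‖y‖ ≤ 1 := by
    filter_upwards [Metric.closedBall_mem_nhds (0 : ℝ × ℝ) one_pos] with y hy
    simpa using hy
  have mconj : Measurable fun z : ℂ => conj z := Complex.continuous_conj.measurable
  have avI : Integrable fun p => ‖a p‖ * ‖v p‖ := by
    have h := memLp_one_iff_integrable.mp (MemLp.mul (r := 1) hN.norm aL.norm)
    exact h
  -- the weight `m y` tends to `1` as `y → 0`, by dominated convergence
  have lim1 : Filter.Tendsto (fun y => ∫ p, a p * ((m y p : ℝ) * conj (v p))) (nhds 0)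
      (nhds (∫ p, a p * conj (v p))) := by
    refine tendsto_integral_filter_of_dominated_convergence (fun p => 2 ^ N * (‖a p‖ * ‖v p‖))
      (Filter.Eventually.of_forall fun y => ?_) ?_ (avI.const_mul _)
      (Filter.Eventually.of_forall fun p => ?_)
    · have := mm y
      exact Measurable.aestronglyMeasurable (by fun_prop)
    · filter_upwards [hev] with y hy
      refine Filter.Eventually.of_forall fun p => ?_
      rw [norm_mul, norm_mul, Complex.norm_real, RCLike.norm_conj, Real.norm_of_nonneg (hm0 y p)]
      calc ‖a p‖ * (m y p * ‖v p‖) ≤ ‖a p‖ * (2 ^ N * ‖v p‖) := by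
            gcongr
            exact hmb y hy p
        _ = _ := by ring
    · have hc := hmc p
      have hc' : Continuous fun y => a p * ((m y p : ℝ) * conj (v p)) := by fun_prop
      have := hc'.tendsto 0
      simpa [hm1] using this
  -- translation is continuous in `L²`
  have lim2 : Filter.Tendsto
      (fun y => ∫ p, a p * ((m y p : ℝ) * (conj (v (p + y)) - conj (v p)))) (nhds 0) (nhds 0) := by
    rw [tendsto_zero_iff_enorm_tendsto_zero]
    set A : ℝ≥0∞ := ∫⁻ p, (2 ^ N * ‖a p‖ₑ) ^ 2 with hA
    have hAtop : A ≠ ⊤ := by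
      have h := (memLp_two_iff_integrable_sq_norm ma.aestronglyMeasurable).mp aL
      have h' := h.lintegral_lt_top
      rw [hA]
      simp only [mul_pow]
      rw [lintegral_const_mul _ (by fun_prop)]
      refine ENNReal.mul_ne_top (by finiteness) (ne_of_lt ?_)
      refine lt_of_le_of_lt (le_of_eq ?_) h'
      refine lintegral_congr fun p => ?_
      rw [ENNReal.ofReal_pow (norm_nonneg _), ofReal_norm]
    have hbound : ∀ᶠ y : ℝ × ℝ in nhds 0,
        ‖∫ p, a p * ((m y p : ℝ) * (conj (v (p + y)) - conj (v p)))‖ₑ ≤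
          (A * ∫⁻ x, ‖v (x + y) - v x‖ₑ ^ 2) ^ (1 / 2 : ℝ) := by
      filter_upwards [hev] with y hy
      have e1 : ‖∫ p, a p * ((m y p : ℝ) * (conj (v (p + y)) - conj (v p)))‖ₑ ≤
          ∫⁻ p, (2 ^ N * ‖a p‖ₑ) * ‖v (p + y) - v p‖ₑ := by
        refine (enorm_integral_le_lintegral_enorm _).trans (lintegral_mono fun p => ?_)
        rw [enorm_mul, enorm_mul, ← map_sub]
        have e2 : ‖((m y p : ℝ) : ℂ)‖ₑ ≤ 2 ^ N := by
          rw [← ofReal_norm, Complex.norm_real, Real.norm_of_nonneg (hm0 y p)]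
          refine (ENNReal.ofReal_le_ofReal (hmb y hy p)).trans_eq ?_
          rw [ENNReal.ofReal_pow (by norm_num)]
          simp
        have e3 : ‖conj (v (p + y) - v p)‖ₑ = ‖v (p + y) - v p‖ₑ := by
          rw [← ofReal_norm, RCLike.norm_conj, ofReal_norm]
        rw [e3]
        calc ‖a p‖ₑ * (‖((m y p : ℝ) : ℂ)‖ₑ * ‖v (p + y) - v p‖ₑ)
            ≤ ‖a p‖ₑ * (2 ^ N * ‖v (p + y) - v p‖ₑ) := by gcongr
          _ = _ := by ring
      have e4 := (pow_le_pow_left' e1 2).trans (sq_lintegral_mul_le volume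
        (f := fun p => 2 ^ N * ‖a p‖ₑ) (g := fun p => ‖v (p + y) - v p‖ₑ)
        (by fun_prop) (by fun_prop))
      rw [← ENNReal.rpow_two] at e4
      have e5 := ENNReal.rpow_le_rpow e4 (z := 1 / 2) (by norm_num)
      rw [← ENNReal.rpow_mul] at e5
      norm_num at e5
      norm_num
      exact e5
    have h3 := tendsto_lintegral_translate_sub hN
    have h4 : Filter.Tendsto (fun y => (A * ∫⁻ x, ‖v (x + y) - v x‖ₑ ^ 2) ^ (1 / 2 : ℝ)) (nhds 0)
        (nhds 0) := by
      have h5 := (ENNReal.Tendsto.const_mul h3 (Or.inr hAtop)).ennrpow_const (1 / 2)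
      simpa using h5
    exact tendsto_of_tendsto_of_tendsto_of_le_of_le' tendsto_const_nhds h4
      (Filter.Eventually.of_forall fun _ => zero_le) hbound
  have hG0 : ∫ p, κ p * conj (u₂ p) * conj (u₁ (p + 0)) = ∫ p, a p * conj (v p) := by
    refine integral_congr_ae (Filter.Eventually.of_forall fun p => ?_)
    dsimp only
    rw [hsplit 0 p]
    simp [hm1]
  rw [ContinuousAt, hG0, ← add_zero (∫ p, a p * conj (v p))]
  refine (lim1.add lim2).congr' ?_
  filter_upwards [hev] with y hy
  have my := mm y
  have I1 : Integrable fun p => a p * ((m y p : ℝ) * conj (v p)) := by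
    refine (avI.const_mul (2 ^ N)).mono' (Measurable.aestronglyMeasurable (by fun_prop))
      (Filter.Eventually.of_forall fun p => ?_)
    rw [norm_mul, norm_mul, Complex.norm_real, RCLike.norm_conj, Real.norm_of_nonneg (hm0 y p)]
    calc ‖a p‖ * (m y p * ‖v p‖) ≤ ‖a p‖ * (2 ^ N * ‖v p‖) := by
          gcongr
          exact hmb y hy p
      _ = _ := by ring
  have avI' : Integrable fun p => ‖a p‖ * ‖v (p + y)‖ := by
    have h := memLp_one_iff_integrable.mp (MemLp.mul (r := 1)
      (hN.comp_measurePreserving (measurePreserving_add_right volume y)).norm aL.norm)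
    exact h
  have I2 : Integrable fun p => a p * ((m y p : ℝ) * (conj (v (p + y)) - conj (v p))) := by
    refine ((avI'.add avI).const_mul (2 ^ N)).mono' (Measurable.aestronglyMeasurable (by fun_prop))
      (Filter.Eventually.of_forall fun p => ?_)
    rw [norm_mul, norm_mul, Complex.norm_real, Real.norm_of_nonneg (hm0 y p), ← map_sub,
      RCLike.norm_conj]
    calc ‖a p‖ * (m y p * ‖v (p + y) - v p‖) ≤ ‖a p‖ * (2 ^ N * (‖v (p + y)‖ + ‖v p‖)) := by
          gcongr
          · exact hmb y hy p
          · exact norm_sub_le _ _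
      _ = _ := by
          simp only [Pi.add_apply]
          ring
  rw [← integral_add I1 I2]
  refine integral_congr_ae (Filter.Eventually.of_forall fun p => ?_)
  dsimp only
  rw [hsplit y p]
  ring

/-- Absolute convergence of the double integral `∬ ρ(y) κ(p) ū₂(p) ū₁(p + y) dp dy`. -/
theorem integrable_correlation (m₁ : Measurable u₁) (m₂ : Measurable u₂) (h₁ : IsTempered u₁)
    (h₂ : IsTempered u₂) :
    Integrable (fun z : (ℝ × ℝ) × (ℝ × ℝ) =>
      κ z.1 * conj (u₂ z.1) * (ρ z.2 * conj (u₁ (z.1 + z.2)))) (volume.prod volume) := by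
  obtain ⟨N, hN⟩ := h₁
  obtain ⟨M, hM⟩ := h₂
  obtain ⟨C, hC, hb⟩ := exists_polynomial_bound κ (N + M)
  obtain ⟨D, hD, hb'⟩ := exists_polynomial_bound ρ N
  have mκ : Measurable κ := κ.continuous.measurable
  have mρ : Measurable ρ := ρ.continuous.measurable
  have mconj : Measurable fun z : ℂ => conj z := Complex.continuous_conj.measurable
  have hint : Integrable (fun z : (ℝ × ℝ) × (ℝ × ℝ) =>
      κ z.1 * conj (u₂ z.1) * (ρ (z.2 - z.1) * conj (u₁ z.2))) (volume.prod volume) := by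
    have h := ((hM.norm.mul_prod hN.norm).const_mul (C * D))
    refine h.mono' (Measurable.aestronglyMeasurable (by fun_prop))
      (Filter.Eventually.of_forall fun z => ?_)
    obtain ⟨p, q⟩ := z
    dsimp only
    simp only [norm_mul, norm_smul, RCLike.norm_conj]
    have hp : 0 < 1 + ‖p‖ := by positivity
    have hq : 0 < 1 + ‖q‖ := by positivity
    rw [Real.norm_of_nonneg (by positivity), Real.norm_of_nonneg (by positivity)]
    have e1 := hb p
    have e2 := hb' (q - p)
    have e3 : 1 + ‖q‖ ≤ (1 + ‖p‖) * (1 + ‖q - p‖) := by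
      have : ‖q‖ ≤ ‖p‖ + ‖q - p‖ := by
        calc ‖q‖ = ‖p + (q - p)‖ := by rw [add_sub_cancel]
          _ ≤ _ := norm_add_le _ _
      nlinarith [norm_nonneg p, norm_nonneg (q - p)]
    have e4 : (1 + ‖q‖) ^ N * ‖ρ (q - p)‖ ≤ (1 + ‖p‖) ^ N * D := by
      calc (1 + ‖q‖) ^ N * ‖ρ (q - p)‖ ≤ ((1 + ‖p‖) * (1 + ‖q - p‖)) ^ N * ‖ρ (q - p)‖ := by gcongr
        _ = (1 + ‖p‖) ^ N * ((1 + ‖q - p‖) ^ N * ‖ρ (q - p)‖) := by rw [mul_pow]; ring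
        _ ≤ _ := by gcongr
    calc ‖κ p‖ * ‖u₂ p‖ * (‖ρ (q - p)‖ * ‖u₁ q‖)
        = ‖κ p‖ * ‖u₂ p‖ * (((1 + ‖q‖) ^ N * ‖ρ (q - p)‖) * (((1 + ‖q‖) ^ N)⁻¹ * ‖u₁ q‖)) := by
          field_simp
      _ ≤ ‖κ p‖ * ‖u₂ p‖ * (((1 + ‖p‖) ^ N * D) * (((1 + ‖q‖) ^ N)⁻¹ * ‖u₁ q‖)) := by gcongr
      _ = ((1 + ‖p‖) ^ (N + M) * ‖κ p‖) * (D * (((1 + ‖p‖) ^ M)⁻¹ * ‖u₂ p‖ *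
            (((1 + ‖q‖) ^ N)⁻¹ * ‖u₁ q‖))) := by
          rw [pow_add]
          field_simp
      _ ≤ C * (D * (((1 + ‖p‖) ^ M)⁻¹ * ‖u₂ p‖ * (((1 + ‖q‖) ^ N)⁻¹ * ‖u₁ q‖))) := by gcongr
      _ = _ := by ring
  have hS := measurePreserving_prod_add (volume : Measure (ℝ × ℝ)) (volume : Measure (ℝ × ℝ))
  have h := (hS.integrable_comp (Measurable.aestronglyMeasurable (by fun_prop))).mpr hint
  refine h.congr (Filter.Eventually.of_forall fun z => ?_)
  simp only [Function.comp, add_sub_cancel_left]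

end

/-! ### The Fourier transform of a product -/

section

variable {μ : Measure ℝ} {u u₁ u₂ h h₁ h₂ : ℝ × ℝ → ℂ}

theorem integrable_conj {α : Type*} [MeasurableSpace α] {ν : Measure α} {f : α → ℂ}
    (hf : Integrable f ν) : Integrable (fun x => conj (f x)) ν :=
  (Complex.conjCLE : ℂ →L[ℝ] ℂ).integrable_comp hf

/-- Parseval's formula: the distribution `ū` is recovered from the Fourier transform `h` of `u`. -/
theorem integral_mul_conj (hu : IsTempered u) (hh : HasFourierTransform μ (toDistribution u) h)
    (κ : 𝓢(ℝ × ℝ, ℂ)) :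
    ∫ p, κ p * conj (u p) = ((((2 * Real.pi) ^ 2)⁻¹ : ℝ) : ℂ) *
      ∫ q, schwartzFourier κ q * conj (h q) ∂μ.prod volume := by
  set c : ℂ := ((((2 * Real.pi) ^ 2)⁻¹ : ℝ) : ℂ) with hc
  have hcc : c * (((2 * Real.pi) ^ 2 : ℝ) : ℂ) = 1 := by
    rw [hc, ← Complex.ofReal_mul, inv_mul_cancel₀ (by have := Real.pi_pos; positivity),
      Complex.ofReal_one]
  set φ : 𝓢(ℝ × ℝ, ℂ) := c • schwartzConj (schwartzFourier κ) with hφ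
  have hφ' : ∀ p, schwartzFourier φ p = conj (κ p) := by
    intro p
    rw [hφ, map_smul]
    have h1 : (c • schwartzFourier (schwartzConj (schwartzFourier κ))) p =
      c * schwartzFourier (schwartzConj (schwartzFourier κ)) p := rfl
    rw [h1, schwartzFourier_conj, schwartzFourier_schwartzFourier, neg_neg, map_mul,
      Complex.conj_ofReal, ← mul_assoc, hcc, one_mul]
  have h2 := (hh.2 φ).2
  rw [toDistribution_apply hu] at h2
  have h3 := congrArg conj h2
  rw [← integral_conj, ← integral_conj] at h3
  simp only [hφ', map_mul, Complex.conj_conj] at h3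
  rw [h3, ← integral_const_mul]
  congr 1
  ext q
  have h4 : φ q = c * conj (schwartzFourier κ q) := rfl
  rw [h4, map_mul, Complex.conj_conj, hc, Complex.conj_ofReal]
  ring

/-- Parseval's formula for a test function that is given as a Fourier transform. -/
theorem integral_schwartzFourier_mul_conj (hu : IsTempered u)
    (hh : HasFourierTransform μ (toDistribution u) h) (φ : 𝓢(ℝ × ℝ, ℂ)) :
    ∫ p, schwartzFourier φ p * conj (u p) = ∫ q, φ (-q) * conj (h q) ∂μ.prod volume := by
  have hpi := Real.pi_pos
  rw [integral_mul_conj hu hh]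
  simp only [schwartzFourier_schwartzFourier, mul_assoc]
  rw [integral_const_mul, ← mul_assoc, ← Complex.ofReal_mul, inv_mul_cancel₀ (by positivity),
    Complex.ofReal_one, one_mul]

theorem exists_lintegral_reflect_le (μ : Measure ℝ) [IsFrequencyMeasure μ] (φ : 𝓢(ℝ × ℝ, ℂ)) :
    ∃ C : ℝ≥0∞, C ≠ ⊤ ∧ ∀ q, ∫⁻ z, ‖φ (-z - q)‖ₑ ∂μ.prod volume ≤ C := by
  obtain ⟨C, hC, hb⟩ := exists_decay φ
  obtain ⟨D, hD, hd⟩ := IsFrequencyMeasure.decay (μ := μ) 2 (by norm_num)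
  obtain ⟨E, hE, he⟩ := IsFrequencyMeasure.decay (μ := volume) 2 (by norm_num)
  refine ⟨ENNReal.ofReal C * (D * E), by finiteness, fun q => ?_⟩
  have hpt : ∀ z : ℝ × ℝ, ‖φ (-z - q)‖ₑ ≤
      ENNReal.ofReal C * (jap (z.1 - -q.1) ^ (-2 : ℝ) * jap (z.2 - -q.2) ^ (-2 : ℝ)) := by
    intro z
    rw [← ofReal_norm]
    refine (ENNReal.ofReal_le_ofReal (hb _)).trans_eq ?_
    have p1 := bracket_pos (-z - q).1
    have p2 := bracket_pos (-z - q).2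
    rw [ENNReal.ofReal_mul hC, ENNReal.ofReal_mul (by positivity), ← jap_rpow, ← jap_rpow,
      ← jap_neg (-z - q).1, ← jap_neg (-z - q).2]
    simp [add_comm]
  refine (lintegral_mono hpt).trans ?_
  rw [lintegral_const_mul _ (by fun_prop),
    lintegral_prod_mul (f := fun x => jap (x - -q.1) ^ (-2 : ℝ))
      (g := fun x => jap (x - -q.2) ^ (-2 : ℝ)) (Measurable.aemeasurable (by fun_prop))
      (Measurable.aemeasurable (by fun_prop))]
  gcongr
  · exact hd _
  · exact he _

theorem mul_le_sq_add_sq (a b : ℝ≥0∞) : a * b ≤ a ^ 2 + b ^ 2 := by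
  rcases le_total a b with h | h
  · exact (mul_le_mul_left h b).trans (by rw [sq b]; exact le_add_self)
  · exact (mul_le_mul_right h a).trans (by rw [sq a]; exact le_self_add)

/-- Absolute convergence on the frequency side: the kernel `φ(-z - q)` is integrable in each
variable uniformly in the other one. -/
theorem integrable_frequency_kernel [IsFrequencyMeasure μ] (m₁ : Measurable h₁)
    (m₂ : Measurable h₂) (L₁ : ∫⁻ q, ‖h₁ q‖ₑ ^ 2 ∂μ.prod volume ≠ ⊤)
    (L₂ : ∫⁻ q, ‖h₂ q‖ₑ ^ 2 ∂μ.prod volume ≠ ⊤) (φ : 𝓢(ℝ × ℝ, ℂ)) :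
    Integrable (fun z : (ℝ × ℝ) × (ℝ × ℝ) => conj (h₁ z.1) * (φ (-z.2 - z.1) * conj (h₂ z.2)))
      ((μ.prod volume).prod (μ.prod volume)) := by
  obtain ⟨C, hC, hb⟩ := exists_lintegral_reflect_le μ φ
  have mφ : Measurable φ := φ.continuous.measurable
  have mconj : Measurable fun z : ℂ => conj z := Complex.continuous_conj.measurable
  refine ⟨Measurable.aestronglyMeasurable (by fun_prop), ?_⟩
  have hpt : ∀ z : (ℝ × ℝ) × (ℝ × ℝ),
      ‖conj (h₁ z.1) * (φ (-z.2 - z.1) * conj (h₂ z.2))‖ₑ ≤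
        ‖h₁ z.1‖ₑ ^ 2 * ‖φ (-z.2 - z.1)‖ₑ + ‖h₂ z.2‖ₑ ^ 2 * ‖φ (-z.1 - z.2)‖ₑ := by
    intro z
    rw [enorm_mul, enorm_mul, RCLike.enorm_conj, RCLike.enorm_conj, neg_sub_comm z.1 z.2, ← add_mul]
    calc _ = (‖h₁ z.1‖ₑ * ‖h₂ z.2‖ₑ) * ‖φ (-z.2 - z.1)‖ₑ := by ring
      _ ≤ _ := mul_le_mul_left (mul_le_sq_add_sq _ _) _
  refine lt_of_le_of_lt (lintegral_mono hpt) ?_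
  rw [lintegral_add_left (by fun_prop), ENNReal.add_lt_top]
  constructor
  · rw [lintegral_prod _ (by fun_prop)]
    refine lt_of_le_of_lt (b := ∫⁻ q, ‖h₁ q‖ₑ ^ 2 * C ∂μ.prod volume)
      (lintegral_mono fun q => ?_) ?_
    · dsimp only
      rw [lintegral_const_mul _ (by fun_prop)]
      gcongr
      exact hb q
    · rw [lintegral_mul_const _ (by fun_prop)]
      exact ENNReal.mul_lt_top L₁.lt_top hC.lt_top
  · rw [lintegral_prod_symm _ (by fun_prop)]
    refine lt_of_le_of_lt (b := ∫⁻ q, ‖h₂ q‖ₑ ^ 2 * C ∂μ.prod volume)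
      (lintegral_mono fun q => ?_) ?_
    · dsimp only
      rw [lintegral_const_mul _ (by fun_prop)]
      gcongr
      exact hb q
    · rw [lintegral_mul_const _ (by fun_prop)]
      exact ENNReal.mul_lt_top L₂.lt_top hC.lt_top

/-- The product formula, averaged over translates of one factor against a Schwartz weight `ρ`.
The weight makes all double integrals absolutely convergent, which is not the case without it. -/
theorem integral_correlation (m₁ : Measurable u₁) (m₂ : Measurable u₂) (t₁ : IsTempered u₁)
    (t₂ : IsTempered u₂) [IsFrequencyMeasure μ] (mh₁ : Measurable h₁)
    (hh₁ : HasFourierTransform μ (toDistribution u₁) h₁)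
    (hh₂ : HasFourierTransform μ (toDistribution u₂) h₂) (φ ρ : 𝓢(ℝ × ℝ, ℂ)) :
    ∫ y, ρ y * ∫ p, schwartzFourier φ p * conj (u₂ p) * conj (u₁ (p + y)) =
      ((((2 * Real.pi) ^ 2)⁻¹ : ℝ) : ℂ) * ∫ q, schwartzFourier ρ q *
        (conj (h₁ q) * ∫ z, φ (-z - q) * conj (h₂ z) ∂μ.prod volume) ∂μ.prod volume := by
  set c : ℂ := ((((2 * Real.pi) ^ 2)⁻¹ : ℝ) : ℂ) with hc
  set κ := schwartzFourier φ with hκ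
  have hint := integrable_correlation κ ρ m₁ m₂ t₁ t₂
  have mκ : Measurable κ := κ.continuous.measurable
  have mρ : Measurable (schwartzFourier ρ) := (schwartzFourier ρ).continuous.measurable
  have mconj : Measurable fun z : ℂ => conj z := Complex.continuous_conj.measurable
  have mwave : Measurable fun z : (ℝ × ℝ) × (ℝ × ℝ) => wave z.1 z.2 := continuous_wave.measurable
  have hinner : ∀ p, ∫ y, ρ y * conj (u₁ (p + y)) =
      c * ∫ q, wave q p * schwartzFourier ρ q * conj (h₁ q) ∂μ.prod volume := by
    intro p
    have e1 := integral_mul_conj t₁ hh₁ (ρ.compSubConstCLM ℂ p)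
    simp only [schwartzFourier_compSubConst, SchwartzMap.compSubConstCLM_apply] at e1
    rw [← hc] at e1
    rw [← e1, ← integral_add_left_eq_self (fun y => ρ (y - p) * conj (u₁ y)) p]
    simp only [add_sub_cancel_left]
  have hK : ∀ q, ∫ p, wave q p * κ p * conj (u₂ p) =
      ∫ z, φ (-z - q) * conj (h₂ z) ∂μ.prod volume := by
    intro q
    have e1 := integral_schwartzFourier_mul_conj t₂ hh₂ (φ.compSubConstCLM ℂ q)
    simp only [schwartzFourier_compSubConst, SchwartzMap.compSubConstCLM_apply] at e1
    rw [← e1]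
    simp only [wave_comm q]
    rfl
  have I1 : Integrable fun p => κ p * conj (u₂ p) :=
    (integrable_conj (t₂.integrable_mul (schwartzConj κ))).congr
      (Filter.Eventually.of_forall fun p => by simp [schwartzConj_apply])
  have I2 : Integrable (fun q => schwartzFourier ρ q * conj (h₁ q)) (μ.prod volume) :=
    (integrable_conj (hh₁.2 (schwartzConj (schwartzFourier ρ))).1).congr
      (Filter.Eventually.of_forall fun p => by simp [schwartzConj_apply])
  calc ∫ y, ρ y * ∫ p, κ p * conj (u₂ p) * conj (u₁ (p + y))
      = ∫ y, ∫ p, κ p * conj (u₂ p) * (ρ y * conj (u₁ (p + y))) := by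
        simp only [← integral_const_mul]
        congr 1
        ext y
        congr 1
        ext p
        ring
    _ = ∫ p, ∫ y, κ p * conj (u₂ p) * (ρ y * conj (u₁ (p + y))) :=
        (integral_integral_swap (f := fun p y => κ p * conj (u₂ p) * (ρ y * conj (u₁ (p + y))))
          hint).symm
    _ = ∫ p, c * ∫ q, κ p * conj (u₂ p) * (wave q p * schwartzFourier ρ q * conj (h₁ q))
          ∂μ.prod volume := by
        refine integral_congr_ae (Filter.Eventually.of_forall fun p => ?_)
        simp only [integral_const_mul, hinner]
        ring
    _ = c * ∫ q, (∫ p, κ p * conj (u₂ p) * (wave q p * schwartzFourier ρ q * conj (h₁ q)))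
          ∂μ.prod volume := by
        rw [integral_const_mul]
        congr 1
        refine integral_integral_swap
          (f := fun p q => κ p * conj (u₂ p) * (wave q p * schwartzFourier ρ q * conj (h₁ q))) ?_
        refine (I1.mul_prod I2).mono (Measurable.aestronglyMeasurable (by
          unfold Function.uncurry
          fun_prop)) (Filter.Eventually.of_forall fun z => ?_)
        simp only [Function.uncurry, norm_mul, norm_wave, one_mul, le_refl]
    _ = _ := by
        congr 2
        ext q
        rw [← hK q, ← integral_const_mul, ← integral_const_mul]
        congr 1
        ext p
        ring

/-- The Fourier transform of `ū₁ ū₂`, in terms of the Fourier transforms `h₁` and `h₂` of the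
factors. -/
def productTransform (μ : Measure ℝ) (h₁ h₂ : ℝ × ℝ → ℂ) (Q : ℝ × ℝ) : ℂ :=
  ((((2 * Real.pi) ^ 2)⁻¹ : ℝ) : ℂ) * ∫ z, conj (h₁ (-Q - z)) * conj (h₂ z) ∂μ.prod volume

theorem measurable_productTransform [SFinite μ] (mh₁ : Measurable h₁) (mh₂ : Measurable h₂) :
    Measurable (productTransform μ h₁ h₂) := by
  have mconj : Measurable fun z : ℂ => conj z := Complex.continuous_conj.measurable
  have h1 : Measurable fun z : (ℝ × ℝ) × (ℝ × ℝ) => conj (h₁ (-z.1 - z.2)) * conj (h₂ z.2) := by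
    fun_prop
  exact (h1.stronglyMeasurable.integral_prod_right').measurable.const_mul _

/-- The product formula as an iterated integral: in the averaged formula the weight `ρ` runs through
an approximate identity, whose Fourier transforms are bounded by `1` and tend to `1`. -/
theorem integral_schwartzFourier_mul_conjMul (m₁ : Measurable u₁) (m₂ : Measurable u₂)
    (t₁ : IsTemperedL2 u₁) (t₂ : IsTemperedL2 u₂) [IsFrequencyMeasure μ] (mh₁ : Measurable h₁)
    (mh₂ : Measurable h₂) (L₁ : ∫⁻ q, ‖h₁ q‖ₑ ^ 2 ∂μ.prod volume ≠ ⊤)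
    (L₂ : ∫⁻ q, ‖h₂ q‖ₑ ^ 2 ∂μ.prod volume ≠ ⊤)
    (hh₁ : HasFourierTransform μ (toDistribution u₁) h₁)
    (hh₂ : HasFourierTransform μ (toDistribution u₂) h₂) (φ : 𝓢(ℝ × ℝ, ℂ)) :
    ∫ p, schwartzFourier φ p * conjMul u₁ u₂ p = ((((2 * Real.pi) ^ 2)⁻¹ : ℝ) : ℂ) *
      ∫ q, conj (h₁ q) * ∫ z, φ (-z - q) * conj (h₂ z) ∂μ.prod volume ∂μ.prod volume := by
  set G : ℝ × ℝ → ℂ := fun y => ∫ p, schwartzFourier φ p * conj (u₂ p) * conj (u₁ (p + y)) with hG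
  have mφ : Measurable φ := φ.continuous.measurable
  have mκ : Measurable (schwartzFourier φ) := (schwartzFourier φ).continuous.measurable
  have mconj : Measurable fun z : ℂ => conj z := Complex.continuous_conj.measurable
  have hGm : AEStronglyMeasurable G volume := by
    have h1 : Measurable fun z : (ℝ × ℝ) × (ℝ × ℝ) =>
      schwartzFourier φ z.2 * conj (u₂ z.2) * conj (u₁ (z.2 + z.1)) := by fun_prop
    exact (h1.stronglyMeasurable.integral_prod_right').aestronglyMeasurable
  have hGc : ContinuousAt G 0 := continuousAt_correlation (schwartzFourier φ) m₁ m₂ t₁ t₂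
  let b : ℕ → ContDiffBump (0 : ℝ × ℝ) := fun n =>
    ⟨(1 / 2) * (1 / ((n : ℝ) + 1)), 1 / ((n : ℝ) + 1), by positivity, by
      have : 0 < 1 / ((n : ℝ) + 1) := by positivity
      linarith⟩
  have hb : Filter.Tendsto (fun n => (b n).rOut) Filter.atTop (nhds 0) :=
    tendsto_one_div_add_atTop_nhds_zero_nat
  let β : ℕ → ℝ × ℝ → ℝ := fun n => (b n).normed volume
  have hβc : ∀ n, HasCompactSupport (fun y => (β n y : ℂ)) := fun n =>
    (b n).hasCompactSupport_normed.comp_left Complex.ofReal_zero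
  have hβs : ∀ n, ContDiff ℝ (↑(⊤ : ℕ∞)) (fun y => (β n y : ℂ)) := fun n =>
    Complex.ofRealCLM.contDiff.comp (b n).contDiff_normed
  let ρ : ℕ → 𝓢(ℝ × ℝ, ℂ) := fun n => (hβc n).toSchwartzMap (hβs n)
  have hρ : ∀ n y, ρ n y = (β n y : ℂ) := fun n y => rfl
  -- integrals against the approximate identity
  have happrox : ∀ g : ℝ × ℝ → ℂ, AEStronglyMeasurable g volume → ContinuousAt g 0 →
      Filter.Tendsto (fun n => ∫ y, ρ n y * g y) Filter.atTop (nhds (g 0)) := by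
    intro g hg hgc
    have h1 : AEStronglyMeasurable (fun y => g (-y)) volume :=
      hg.comp_measurePreserving (Measure.measurePreserving_neg volume)
    have h2 := ContDiffBump.convolution_tendsto_right (μ := volume) (φ := b) (l := Filter.atTop)
      (g := fun _ y => g (-y)) (k := fun _ => (0 : ℝ × ℝ)) (x₀ := 0) (z₀ := g 0) hb
      (Filter.Eventually.of_forall fun _ => h1) (by
        have h3 : Filter.Tendsto (fun y : ℝ × ℝ => g (-y)) (nhds 0) (nhds (g 0)) := by
          have h4 : ContinuousAt (fun y : ℝ × ℝ => g (-y)) 0 :=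
            ContinuousAt.comp (by simpa using hgc) continuous_neg.continuousAt
          simpa [ContinuousAt] using h4
        exact h3.comp Filter.tendsto_snd) tendsto_const_nhds
    refine h2.congr fun n => ?_
    rw [convolution_def]
    congr 1
    ext y
    simp [hρ, β]
  have lim1 : Filter.Tendsto (fun n => ∫ y, ρ n y * G y) Filter.atTop (nhds (G 0)) :=
    happrox G hGm hGc
  have hker := integrable_frequency_kernel mh₁ mh₂ L₁ L₂ φ
  have lim2 : Filter.Tendsto (fun n => ∫ q, schwartzFourier (ρ n) q *
      (conj (h₁ q) * ∫ z, φ (-z - q) * conj (h₂ z) ∂μ.prod volume) ∂μ.prod volume) Filter.atTop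
      (nhds (∫ q, conj (h₁ q) * ∫ z, φ (-z - q) * conj (h₂ z) ∂μ.prod volume ∂μ.prod volume)) := by
    have hI : Integrable (fun q => conj (h₁ q) * ∫ z, φ (-z - q) * conj (h₂ z) ∂μ.prod volume)
        (μ.prod volume) := by
      refine hker.integral_prod_left.congr (Filter.Eventually.of_forall fun q => ?_)
      dsimp only
      rw [integral_const_mul]
    refine tendsto_integral_of_dominated_convergence
      (fun q => ‖conj (h₁ q) * ∫ z, φ (-z - q) * conj (h₂ z) ∂μ.prod volume‖) (fun n => ?_) hI.norm
      (fun n => Filter.Eventually.of_forall fun q => ?_) (Filter.Eventually.of_forall fun q => ?_)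
    · exact ((schwartzFourier (ρ n)).continuous.aestronglyMeasurable).mul hI.aestronglyMeasurable
    · rw [norm_mul]
      refine mul_le_of_le_one_left (norm_nonneg _) ?_
      rw [schwartzFourier_eq_integral_wave]
      refine (norm_integral_le_integral_norm _).trans ?_
      rw [← (b n).integral_normed (μ := volume)]
      refine le_of_eq (integral_congr_ae (Filter.Eventually.of_forall fun y => ?_))
      dsimp only
      rw [norm_mul, norm_wave, one_mul, hρ, Complex.norm_real,
        Real.norm_of_nonneg ((b n).nonneg_normed y)]
    · have hwc : Continuous fun y => wave q y :=
        continuous_wave.comp (Continuous.prodMk continuous_const continuous_id)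
      have h1 := happrox (fun y => wave q y) hwc.aestronglyMeasurable hwc.continuousAt
      have h0 : wave q 0 = 1 := by simp [wave]
      rw [h0] at h1
      have h2 : Filter.Tendsto (fun n => schwartzFourier (ρ n) q) Filter.atTop (nhds 1) := by
        refine h1.congr fun n => ?_
        rw [schwartzFourier_eq_integral_wave]
        simp only [mul_comm]
      simpa using h2.mul_const (conj (h₁ q) * ∫ z, φ (-z - q) * conj (h₂ z) ∂μ.prod volume)
  have heq : ∀ n, ∫ y, ρ n y * G y = _ := fun n =>
    integral_correlation m₁ m₂ t₁.isTempered t₂.isTempered mh₁ hh₁ hh₂ φ (ρ n)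
  have h5 := tendsto_nhds_unique (lim1.congr heq) (lim2.const_mul _)
  rw [← h5, hG]
  congr 1
  ext p
  simp only [conjMul, add_zero]
  ring

/-- The transform of `∂ₓ(ū₁ ū₂)` is `iξ` times the convolution of the transforms of the factors. -/
theorem hasFourierTransform_dxLine_conjMul (m₁ : Measurable u₁) (m₂ : Measurable u₂)
    (t₁ : IsTemperedL2 u₁) (t₂ : IsTemperedL2 u₂) [IsFrequencyMeasure μ] (mh₁ : Measurable h₁)
    (mh₂ : Measurable h₂) (L₁ : ∫⁻ q, ‖h₁ q‖ₑ ^ 2 ∂μ.prod volume ≠ ⊤)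
    (L₂ : ∫⁻ q, ‖h₂ q‖ₑ ^ 2 ∂μ.prod volume ≠ ⊤)
    (hh₁ : HasFourierTransform μ (toDistribution u₁) h₁)
    (hh₂ : HasFourierTransform μ (toDistribution u₂) h₂) :
    HasFourierTransform μ (dxLine (conjMul u₁ u₂))
      (fun Q => Complex.I * Q.1 * productTransform μ h₁ h₂ Q) := by
  have mconj : Measurable fun z : ℂ => conj z := Complex.continuous_conj.measurable
  have mH := measurable_productTransform (μ := μ) mh₁ mh₂
  have hprod : ∀ φ : 𝓢(ℝ × ℝ, ℂ),
      Integrable (fun Q => φ Q * productTransform μ h₁ h₂ Q) (μ.prod volume) ∧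
      ∫ p, schwartzFourier φ p * conjMul u₁ u₂ p =
        ∫ Q, φ Q * productTransform μ h₁ h₂ Q ∂μ.prod volume := by
    intro φ
    have mφ : Measurable φ := φ.continuous.measurable
    set c : ℂ := ((((2 * Real.pi) ^ 2)⁻¹ : ℝ) : ℂ) with hc
    have hker := integrable_frequency_kernel mh₁ mh₂ L₁ L₂ φ
    set Ψ : (ℝ × ℝ) × (ℝ × ℝ) → ℂ :=
      fun z => φ z.2 * (conj (h₁ (-z.2 - z.1)) * conj (h₂ z.1)) with hΨ
    have mΨ : Measurable Ψ := by fun_prop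
    have hS := measurePreserving_shear (μ := μ)
    have hcomp : ∀ z : (ℝ × ℝ) × (ℝ × ℝ), Ψ (z.1, -z.1 - z.2) = (fun z : (ℝ × ℝ) × (ℝ × ℝ) =>
        conj (h₁ z.1) * (φ (-z.2 - z.1) * conj (h₂ z.2))) z.swap := by
      intro z
      simp only [hΨ, Prod.fst_swap, Prod.snd_swap, neg_sub, sub_neg_eq_add]
      rw [show z.2 + z.1 - z.1 = z.2 by abel]
      ring
    have hΨI : Integrable Ψ ((μ.prod volume).prod (μ.prod volume)) := by
      rw [← hS.integrable_comp mΨ.aestronglyMeasurable]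
      exact hker.swap.congr (Filter.Eventually.of_forall fun z => (hcomp z).symm)
    have hΨint : ∫ z, Ψ z ∂(μ.prod volume).prod (μ.prod volume) =
        ∫ q, conj (h₁ q) * ∫ z, φ (-z - q) * conj (h₂ z) ∂μ.prod volume ∂μ.prod volume := by
      rw [← hS.map_eq, integral_map hS.aemeasurable mΨ.aestronglyMeasurable]
      rw [integral_congr_ae (Filter.Eventually.of_forall hcomp),
        integral_prod_swap (fun z : (ℝ × ℝ) × (ℝ × ℝ) =>
          conj (h₁ z.1) * (φ (-z.2 - z.1) * conj (h₂ z.2))), integral_prod _ hker]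
      simp only [integral_const_mul]
    have hslice : ∀ Q, (∫ z, Ψ (z, Q) ∂μ.prod volume) * c = φ Q * productTransform μ h₁ h₂ Q := by
      intro Q
      simp only [hΨ, productTransform, integral_const_mul]
      ring
    constructor
    · exact (hΨI.integral_prod_right.mul_const c).congr (Filter.Eventually.of_forall hslice)
    · rw [integral_schwartzFourier_mul_conjMul m₁ m₂ t₁ t₂ mh₁ mh₂ L₁ L₂ hh₁ hh₂ φ, ← hΨint,
        integral_prod_symm _ hΨI, mul_comm, ← integral_mul_const]
      exact integral_congr_ae (Filter.Eventually.of_forall hslice)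
  refine ⟨Measurable.aestronglyMeasurable (by fun_prop), fun φ => ?_⟩
  obtain ⟨hI, he⟩ := hprod (Complex.I • mulFreq φ)
  have hmul : ∀ Q, (Complex.I • mulFreq φ) Q = Complex.I * Q.1 * φ Q := by
    intro Q
    have h1 : (Complex.I • mulFreq φ) Q = Complex.I * mulFreq φ Q := rfl
    rw [h1, mulFreq_apply, mul_assoc]
  have hfun : ∀ Q, (Complex.I • mulFreq φ) Q * productTransform μ h₁ h₂ Q =
      φ Q * (Complex.I * Q.1 * productTransform μ h₁ h₂ Q) := by
    intro Q
    rw [hmul]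
    ring
  simp only [hfun] at hI he
  refine ⟨hI, ?_⟩
  rw [← he, ← toDistribution_apply (t₁.isTempered_conjMul t₂), dxLine,
    TemperedDistribution.lineDerivOp_apply_apply, lineDerivOp_schwartzFourier, map_neg,
    map_neg, map_neg, neg_neg]

end

/-! ### Localization in time -/

section

variable {μ : Measure ℝ} {u h : ℝ × ℝ → ℂ}

theorem eLpNorm_two_sq {α E : Type*} [MeasurableSpace α] [NormedAddCommGroup E] (f : α → E)
    (ν : Measure α) : eLpNorm f 2 ν ^ 2 = ∫⁻ x, ‖f x‖ₑ ^ 2 ∂ν := by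
  rw [eLpNorm_eq_lintegral_rpow_enorm_toReal (by simp) (by simp)]
  simp only [ENNReal.toReal_ofNat, ENNReal.rpow_two]
  rw [← ENNReal.rpow_natCast, ← ENNReal.rpow_mul,
    show 1 / (2 : ℝ) * ((2 : ℕ) : ℝ) = 1 by norm_num, ENNReal.rpow_one]

theorem MemLp.lintegral_enorm_sq_ne_top {α E : Type*} [MeasurableSpace α] [NormedAddCommGroup E]
    {f : α → E} {ν : Measure α} (hf : MemLp f 2 ν) : ∫⁻ x, ‖f x‖ₑ ^ 2 ∂ν ≠ ⊤ := by
  rw [← eLpNorm_two_sq]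
  exact ENNReal.pow_ne_top hf.eLpNorm_ne_top

theorem memLp_two_of_lintegral_enorm_sq_ne_top {α : Type*} [MeasurableSpace α] {f : α → ℂ}
    {ν : Measure α} (mf : Measurable f) (hf : ∫⁻ x, ‖f x‖ₑ ^ 2 ∂ν ≠ ⊤) : MemLp f 2 ν := by
  refine ⟨mf.aestronglyMeasurable, ?_⟩
  rw [← eLpNorm_two_sq] at hf
  exact lt_top_iff_ne_top.mpr fun h => hf (by rw [h]; simp)

/-- There is a superposition of plane waves with Schwartz density that equals `1` on `[-1, 1]`. -/
theorem exists_schwartz_cutoff : ∃ k : 𝓢(ℝ, ℂ), ∀ s : ℝ, |s| ≤ 1 →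
    ∫ v : ℝ, Complex.exp (-(Complex.I * ((2 * Real.pi * (v * s) : ℝ) : ℂ))) * k v = 1 := by
  let b : ContDiffBump (0 : ℝ) := ⟨1, 2, one_pos, one_lt_two⟩
  have hc : HasCompactSupport (fun y => (b y : ℂ)) :=
    b.hasCompactSupport.comp_left Complex.ofReal_zero
  have hs : ContDiff ℝ (↑(⊤ : ℕ∞)) (fun y => (b y : ℂ)) :=
    Complex.ofRealCLM.contDiff.comp b.contDiff
  let χ : 𝓢(ℝ, ℂ) := hc.toSchwartzMap hs
  refine ⟨𝓕⁻ χ, fun s hs => ?_⟩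
  have h1 : 𝓕 (𝓕⁻ χ) s = χ s := by rw [FourierTransform.fourier_fourierInv_eq]
  have h2 : χ s = 1 := by
    have h3 : b s = 1 := b.one_of_mem_closedBall (by simpa using hs)
    change (b s : ℂ) = 1
    rw [h3, Complex.ofReal_one]
  rw [h2, SchwartzMap.fourier_coe, Real.fourier_real_eq_integral_exp_smul] at h1
  rw [← h1]
  congr 1
  ext v
  rw [smul_eq_mul]
  congr 2
  push_cast
  ring

theorem measurePreserving_add_time [SFinite μ] (c : ℝ) :
    MeasurePreserving (fun q : ℝ × ℝ => q + (0, c)) (μ.prod volume) (μ.prod volume) := by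
  have h1 := (MeasurePreserving.id μ).prod (measurePreserving_add_right (volume : Measure ℝ) c)
  convert h1 using 1
  ext q <;> simp

theorem integrable_time_average [SFinite μ] (k : 𝓢(ℝ, ℂ)) (c : ℝ) {w : ℝ × ℝ → ℂ}
    (mw : Measurable w) (mh : Measurable h) (Lw : ∫⁻ q, ‖w q‖ₑ ^ 2 ∂μ.prod volume ≠ ⊤)
    (L : ∫⁻ q, ‖h q‖ₑ ^ 2 ∂μ.prod volume ≠ ⊤) :
    Integrable (fun z : (ℝ × ℝ) × ℝ => w z.1 * (k z.2 * h (z.1 + (0, c * z.2))))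
      ((μ.prod volume).prod volume) := by
  have mk : Measurable k := k.continuous.measurable
  refine ⟨Measurable.aestronglyMeasurable (by fun_prop), ?_⟩
  have hpt : ∀ z : (ℝ × ℝ) × ℝ, ‖w z.1 * (k z.2 * h (z.1 + (0, c * z.2)))‖ₑ ≤
      ‖k z.2‖ₑ * (‖w z.1‖ₑ ^ 2 + ‖h (z.1 + (0, c * z.2))‖ₑ ^ 2) := by
    intro z
    rw [enorm_mul, enorm_mul]
    calc _ = ‖k z.2‖ₑ * (‖w z.1‖ₑ * ‖h (z.1 + (0, c * z.2))‖ₑ) := by ring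
      _ ≤ _ := mul_le_mul_right (mul_le_sq_add_sq _ _) _
  refine lt_of_le_of_lt (lintegral_mono hpt) ?_
  rw [lintegral_prod_symm _ (by fun_prop)]
  have h1 : ∀ v : ℝ, ∫⁻ q, ‖k v‖ₑ * (‖w q‖ₑ ^ 2 + ‖h (q + (0, c * v))‖ₑ ^ 2) ∂μ.prod volume =
      ‖k v‖ₑ * (∫⁻ q, ‖w q‖ₑ ^ 2 ∂μ.prod volume + ∫⁻ q, ‖h q‖ₑ ^ 2 ∂μ.prod volume) := by
    intro v
    rw [lintegral_const_mul _ (by fun_prop), lintegral_add_left (by fun_prop),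
      (measurePreserving_add_time (μ := μ) (c * v)).lintegral_comp
        (f := fun q => ‖h q‖ₑ ^ 2) (by fun_prop)]
  simp only [h1]
  rw [lintegral_mul_const _ (by fun_prop)]
  exact ENNReal.mul_lt_top k.integrable.2 (ENNReal.add_lt_top.mpr ⟨Lw.lt_top, L.lt_top⟩)

/-- If `u` vanishes for `|t| > T`, multiplication by a cutoff function in time does not change `u`;
so its Fourier transform is reproduced by an average over translates in `τ` at scale `1 / T`. -/
theorem ae_eq_time_average [IsFrequencyMeasure μ] {k : 𝓢(ℝ, ℂ)} (hk : ∀ s : ℝ, |s| ≤ 1 →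
      ∫ v : ℝ, Complex.exp (-(Complex.I * ((2 * Real.pi * (v * s) : ℝ) : ℂ))) * k v = 1)
    {T : ℝ} (hT : 0 < T) (t : IsTempered u) (hu : SupportedIn T u) (mh : Measurable h)
    (L : ∫⁻ q, ‖h q‖ₑ ^ 2 ∂μ.prod volume ≠ ⊤)
    (hh : HasFourierTransform μ (toDistribution u) h) :
    ∀ᵐ q ∂μ.prod volume, h q = ∫ v, k v * h (q + (0, 2 * Real.pi / T * v)) := by
  set c := 2 * Real.pi / T with hc
  have hwave : ∀ p : ℝ × ℝ, |p.2| ≤ T → ∫ v, wave p (0, c * v) * k v = 1 := by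
    intro p hp
    rw [← hk (p.2 / T) (by rw [abs_div, abs_of_pos hT]; exact (div_le_one hT).mpr hp)]
    congr 1
    ext v
    rw [wave, hc]
    congr 4
    field_simp
    simp
  have mwave : Measurable fun z : (ℝ × ℝ) × (ℝ × ℝ) => wave z.1 z.2 := continuous_wave.measurable
  have mk : Measurable k := k.continuous.measurable
  have hφ : ∀ φ : 𝓢(ℝ × ℝ, ℂ), ∫⁻ q, ‖φ q‖ₑ ^ 2 ∂μ.prod volume ≠ ⊤ →
      ∫ q, φ q * h q ∂μ.prod volume =
        ∫ q, φ q * (∫ v, k v * h (q + (0, c * v))) ∂μ.prod volume := by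
    intro φ Lφ
    have mφ : Measurable φ := φ.continuous.measurable
    have I1 := t.integrable_mul (schwartzFourier φ)
    calc ∫ q, φ q * h q ∂μ.prod volume = ∫ p, schwartzFourier φ p * u p := by
          rw [← (hh.2 φ).2, toDistribution_apply t]
      _ = ∫ p, ∫ v, schwartzFourier φ p * u p * (wave p (0, c * v) * k v) := by
          refine integral_congr_ae ?_
          filter_upwards [hu] with p hp
          rw [integral_const_mul]
          rcases le_or_gt |p.2| T with h1 | h1
          · rw [hwave p h1, mul_one]
          · rw [hp h1, mul_zero, zero_mul]
      _ = ∫ v, ∫ p, schwartzFourier φ p * u p * (wave p (0, c * v) * k v) := by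
          refine integral_integral_swap
            (f := fun p v => schwartzFourier φ p * u p * (wave p (0, c * v) * k v)) ?_
          have I2 := I1.mul_prod k.integrable (ν := volume)
          have hw : AEStronglyMeasurable (fun z : (ℝ × ℝ) × ℝ => wave z.1 (0, c * z.2))
              (volume.prod volume) := Measurable.aestronglyMeasurable (by fun_prop)
          refine (I2.bdd_mul (c := 1) hw (Filter.Eventually.of_forall fun z =>
            (norm_wave _ _).le)).congr (Filter.Eventually.of_forall fun z => ?_)
          simp only [Function.uncurry]
          ring
      _ = ∫ v, k v * ∫ q, φ q * h (q + (0, c * v)) ∂μ.prod volume := by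
          congr 1
          ext v
          have e1 := (hh.2 (φ.compSubConstCLM ℂ (0, c * v))).2
          rw [toDistribution_apply t] at e1
          simp only [schwartzFourier_compSubConst, SchwartzMap.compSubConstCLM_apply] at e1
          have hS := measurePreserving_add_time (μ := μ) (c * v)
          have e2 : ∫ q, φ q * h (q + (0, c * v)) ∂μ.prod volume =
              ∫ q, φ (q - (0, c * v)) * h q ∂μ.prod volume := by
            conv_rhs => rw [← hS.map_eq]
            rw [integral_map hS.aemeasurable
              (Measurable.aestronglyMeasurable (by fun_prop))]
            simp only [add_sub_cancel_right]
          rw [e2, ← e1, ← integral_const_mul]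
          congr 1
          ext p
          ring
      _ = ∫ v, ∫ q, φ q * (k v * h (q + (0, c * v))) ∂μ.prod volume := by
          simp only [← integral_const_mul]
          congr 1
          ext v
          congr 1
          ext q
          ring
      _ = ∫ q, (∫ v, φ q * (k v * h (q + (0, c * v)))) ∂μ.prod volume :=
          (integral_integral_swap (f := fun q v => φ q * (k v * h (q + (0, c * v))))
            (integrable_time_average k c mφ mh Lφ L)).symm
      _ = _ := by simp only [integral_const_mul]
  refine ae_eq_of_integral_contDiff_smul_eq
    ((memLp_two_of_lintegral_enorm_sq_ne_top mh L).locallyIntegrable (by norm_num)) ?_ ?_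
  · rw [locallyIntegrable_iff]
    intro K hK
    have mw : Measurable (K.indicator fun _ : ℝ × ℝ => (1 : ℂ)) :=
      measurable_const.indicator hK.measurableSet
    have Lw : ∫⁻ q, ‖K.indicator (fun _ : ℝ × ℝ => (1 : ℂ)) q‖ₑ ^ 2 ∂μ.prod volume ≠ ⊤ :=
      MemLp.lintegral_enorm_sq_ne_top
        (memLp_indicator_const 2 hK.measurableSet 1 (Or.inr hK.measure_lt_top.ne))
    have h1 := (integrable_time_average k c mw mh Lw L).integral_prod_left
    rw [← integrable_indicator_iff hK.measurableSet]
    refine h1.congr (Filter.Eventually.of_forall fun q => ?_)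
    by_cases hq : q ∈ K <;> simp [hq]
  · intro g hg hgc
    have hc' : HasCompactSupport (fun y => (g y : ℂ)) := hgc.comp_left Complex.ofReal_zero
    have hs' : ContDiff ℝ (↑(⊤ : ℕ∞)) (fun y => (g y : ℂ)) := Complex.ofRealCLM.contDiff.comp hg
    have h1 := hφ (hc'.toSchwartzMap hs') (MemLp.lintegral_enorm_sq_ne_top
      (hs'.continuous.memLp_of_hasCompactSupport hc'))
    simp only [Complex.real_smul]
    exact h1

theorem lintegral_comp_add_mul {f : ℝ → ℝ≥0∞} (hf : Measurable f) (a : ℝ) {c : ℝ} (hc : 0 < c) :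
    ∫⁻ v, f (a + c * v) = ENNReal.ofReal c⁻¹ * ∫⁻ v, f v := by
  have h1 : ∫⁻ v, f (a + c * v) = ∫⁻ v, f (a + v) ∂(Measure.map (c * ·) volume) :=
    (lintegral_map (f := fun v => f (a + v)) (by fun_prop) (by fun_prop)).symm
  rw [h1, Real.map_volume_mul_left hc.ne', lintegral_smul_measure, abs_of_pos (by positivity),
    lintegral_add_left_eq_self, smul_eq_mul]

/-- The Fourier transform of a function supported in `|t| ≤ T` is bounded in `τ`, with a bound of
order `T^{1/2}` times its `L²` norm in `τ`, for almost all `ξ`. -/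
theorem exists_ae_sq_le (μ : Measure ℝ) [IsFrequencyMeasure μ] : ∃ C : ℝ, 0 < C ∧
    ∀ {T : ℝ}, 0 < T → ∀ {u h : ℝ × ℝ → ℂ}, IsTempered u → SupportedIn T u → Measurable h →
      ∫⁻ q, ‖h q‖ₑ ^ 2 ∂μ.prod volume ≠ ⊤ → HasFourierTransform μ (toDistribution u) h →
      ∀ᵐ q ∂μ.prod volume,
        ‖h q‖ₑ ^ 2 ≤ ENNReal.ofReal (C * T) * ∫⁻ τ, ‖h (q.1, τ)‖ₑ ^ 2 := by
  obtain ⟨k, hk⟩ := exists_schwartz_cutoff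
  have mk : Measurable k := k.continuous.measurable
  have Lk : ∫⁻ v, ‖k v‖ₑ ^ 2 ≠ ⊤ := MemLp.lintegral_enorm_sq_ne_top (k.memLp 2)
  have hpi := Real.pi_pos
  refine ⟨(∫⁻ v, ‖k v‖ₑ ^ 2).toReal * (2 * Real.pi)⁻¹ + 1, by positivity,
    fun {T} hT {u h} t hu mh L hh => ?_⟩
  filter_upwards [ae_eq_time_average hk hT t hu mh L hh] with q hq
  have h1 : ‖h q‖ₑ ≤ ∫⁻ v, ‖k v‖ₑ * ‖h (q + (0, 2 * Real.pi / T * v))‖ₑ := by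
    rw [hq]
    refine (enorm_integral_le_lintegral_enorm _).trans_eq ?_
    simp only [enorm_mul]
  refine (pow_le_pow_left' h1 2).trans
    ((sq_lintegral_mul_le _ (by fun_prop) (by fun_prop)).trans ?_)
  have h2 : ∫⁻ v, ‖h (q + (0, 2 * Real.pi / T * v))‖ₑ ^ 2 =
      ENNReal.ofReal (2 * Real.pi / T)⁻¹ * ∫⁻ τ, ‖h (q.1, τ)‖ₑ ^ 2 := by
    rw [← lintegral_comp_add_mul (f := fun τ => ‖h (q.1, τ)‖ₑ ^ 2) (by fun_prop) q.2
      (by positivity)]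
    refine lintegral_congr fun v => ?_
    congr 3
    ext <;> simp
  rw [h2, ← mul_assoc]
  gcongr
  rw [← ENNReal.ofReal_toReal Lk, ENNReal.toReal_ofReal ENNReal.toReal_nonneg,
    ← ENNReal.ofReal_mul ENNReal.toReal_nonneg]
  refine ENNReal.ofReal_le_ofReal ?_
  rw [inv_div, add_mul, one_mul, mul_assoc, inv_mul_eq_div]
  linarith

/-- Interpolation between the powers `x` and `1`, with the cut at the scale `R`. -/
theorem rpow_le_add_of_pos {x R q : ℝ} (hx : 0 < x) (hR : 0 < R) (hq₀ : 0 ≤ q) (hq₁ : q ≤ 1) :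
    x ^ q ≤ R ^ (q - 1) * x + R ^ q := by
  rcases le_total x R with h | h
  · have h1 := Real.rpow_le_rpow hx.le h hq₀
    have h2 : 0 ≤ R ^ (q - 1) * x := by positivity
    linarith
  · have h1 : x ^ (q - 1) ≤ R ^ (q - 1) := Real.rpow_le_rpow_of_nonpos hR h (by linarith)
    have h2 : x ^ q = x ^ (q - 1) * x := by
      rw [← Real.rpow_add_one hx.ne', sub_add_cancel]
    have h3 : 0 ≤ R ^ q := by positivity
    rw [h2]
    nlinarith

/-- A function on the line whose square is at most `K` times its integral has at most half of its
mass near the origin, at the scale `R = 1 / (4K)`. So its weighted norms with different exponents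
compare with a power of `R`. -/
theorem lintegral_rpow_mul_le {f : ℝ → ℝ≥0∞} (mf : Measurable f) {K q a : ℝ} (hK : 0 < K)
    (hq₀ : 0 ≤ q) (hq₁ : q ≤ 1) (hfin : ∫⁻ τ, f τ ≠ ⊤)
    (hf : ∀ᵐ τ, f τ ≤ ENNReal.ofReal K * ∫⁻ τ, f τ) :
    ∫⁻ τ, jap (τ + a) ^ q * f τ ≤
      ENNReal.ofReal (3 * (4 * K) ^ (1 - q)) * ∫⁻ τ, jap (τ + a) ^ (1 : ℝ) * f τ := by
  set R : ℝ := (4 * K)⁻¹ with hR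
  have hRpos : 0 < R := by positivity
  set A := ∫⁻ τ, f τ with hA
  set B := ∫⁻ τ, jap (τ + a) ^ (1 : ℝ) * f τ with hB
  set S : Set ℝ := Metric.closedBall (-a) R with hS
  have hnear : ∫⁻ τ in S, f τ ≤ A / 2 := by
    calc ∫⁻ τ in S, f τ ≤ ∫⁻ _ in S, ENNReal.ofReal K * A :=
          lintegral_mono_ae (ae_restrict_of_ae hf)
      _ = ENNReal.ofReal K * A * ENNReal.ofReal (2 * R) := by
          rw [setLIntegral_const, hS, Real.volume_closedBall]
      _ = ENNReal.ofReal (K * (2 * R)) * A := by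
          rw [ENNReal.ofReal_mul hK.le]
          ring
      _ = A / 2 := by
          rw [show K * (2 * R) = 2⁻¹ by rw [hR]; field_simp; norm_num,
            ENNReal.ofReal_inv_of_pos two_pos, ENNReal.ofReal_ofNat, mul_comm,
            ENNReal.div_eq_inv_mul, mul_comm]
  have hfar : ∫⁻ τ in Sᶜ, f τ ≤ ENNReal.ofReal R⁻¹ * B := by
    rw [hB, ← lintegral_const_mul _ (by fun_prop)]
    refine (setLIntegral_mono (by fun_prop) fun τ hτ => ?_).trans (setLIntegral_le_lintegral Sᶜ _)
    rw [← mul_assoc]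
    refine le_mul_of_one_le_left' ?_
    rw [jap_rpow, Real.rpow_one, ← ENNReal.ofReal_mul (by positivity), ENNReal.one_le_ofReal,
      inv_mul_eq_div, one_le_div hRpos]
    have h1 : R < |τ + a| := by
      simpa [hS, Real.dist_eq] using hτ
    exact h1.le.trans (abs_le_bracket _)
  have hA2 : A ≤ 2 * (ENNReal.ofReal R⁻¹ * B) := by
    have h1 : A ≤ A / 2 + ENNReal.ofReal R⁻¹ * B := by
      refine le_trans (le_of_eq ?_) (add_le_add hnear hfar)
      exact (lintegral_add_compl f
        (Metric.isClosed_closedBall.measurableSet : MeasurableSet S)).symm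
    have h2 : A / 2 ≠ ⊤ := (ENNReal.div_lt_top hfin (by simp)).ne
    have h3 : A / 2 ≤ ENNReal.ofReal R⁻¹ * B := by
      rw [← ENNReal.add_le_add_iff_left h2, ENNReal.add_halves]
      exact h1
    calc A = A / 2 + A / 2 := (ENNReal.add_halves A).symm
      _ ≤ _ := by rw [two_mul]; exact add_le_add h3 h3
  have hpt : ∀ τ, jap (τ + a) ^ q * f τ ≤ ENNReal.ofReal (R ^ (q - 1)) *
      (jap (τ + a) ^ (1 : ℝ) * f τ) + ENNReal.ofReal (R ^ q) * f τ := by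
    intro τ
    rw [← mul_assoc, ← add_mul]
    refine mul_le_mul_left ?_ _
    have hb := bracket_pos (τ + a)
    rw [jap_rpow, jap_rpow, Real.rpow_one, ← ENNReal.ofReal_mul (by positivity),
      ← ENNReal.ofReal_add (by positivity) (by positivity)]
    exact ENNReal.ofReal_le_ofReal (rpow_le_add_of_pos hb hRpos hq₀ hq₁)
  refine (lintegral_mono hpt).trans ?_
  rw [lintegral_add_left (by fun_prop), lintegral_const_mul _ (by fun_prop),
    lintegral_const_mul _ (by fun_prop)]
  have hpow : (4 * K) ^ (1 - q) = R ^ (q - 1) := by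
    rw [hR, Real.inv_rpow (by positivity), ← Real.rpow_neg (by positivity), neg_sub]
  calc ENNReal.ofReal (R ^ (q - 1)) * B + ENNReal.ofReal (R ^ q) * A
      ≤ ENNReal.ofReal (R ^ (q - 1)) * B +
        ENNReal.ofReal (R ^ q) * (2 * (ENNReal.ofReal R⁻¹ * B)) := by gcongr
    _ = ENNReal.ofReal (R ^ (q - 1)) * B +
        2 * (ENNReal.ofReal (R ^ q * R⁻¹) * B) := by
        rw [ENNReal.ofReal_mul (by positivity)]
        ring
    _ = ENNReal.ofReal (3 * (4 * K) ^ (1 - q)) * B := by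
        rw [← div_eq_mul_inv, ← Real.rpow_sub_one hRpos.ne', hpow,
          ENNReal.ofReal_mul (by norm_num), ENNReal.ofReal_ofNat]
        ring

/-- Localization in time: for functions supported in `|t| ≤ T`, lowering the exponent of the
modulation weight gains a power of `T`. -/
theorem exists_energy_le (μ : Measure ℝ) [IsFrequencyMeasure μ] : ∃ C : ℝ, 0 < C ∧
    ∀ {T : ℝ}, 0 < T → ∀ {u h : ℝ × ℝ → ℂ}, IsTempered u → SupportedIn T u → Measurable h →
      ∫⁻ q, ‖h q‖ₑ ^ 2 ∂μ.prod volume ≠ ⊤ → HasFourierTransform μ (toDistribution u) h →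
      ∀ {s q : ℝ}, 0 ≤ q → q ≤ 1 → energy μ s q (fun z => ‖h z‖ₑ) ≤
        ENNReal.ofReal (3 * (4 * (C * T)) ^ (1 - q)) * energy μ s 1 (fun z => ‖h z‖ₑ) := by
  obtain ⟨C, hC, hae⟩ := exists_ae_sq_le μ
  refine ⟨C, hC, fun {T} hT {u h} t hu mh L hh {s q} hq₀ hq₁ => ?_⟩
  have hfib := Measure.ae_ae_of_ae_prod (hae hT t hu mh L hh)
  have hfin : ∀ᵐ ξ ∂μ, ∫⁻ τ, ‖h (ξ, τ)‖ₑ ^ 2 < ⊤ := by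
    refine ae_lt_top (Measurable.lintegral_prod_right' (f := fun z : ℝ × ℝ => ‖h z‖ₑ ^ 2)
      (by fun_prop)) ?_
    rwa [← lintegral_prod (fun z : ℝ × ℝ => ‖h z‖ₑ ^ 2) (by fun_prop)]
  have hE : ∀ r : ℝ, energy μ s r (fun z => ‖h z‖ₑ) =
      ∫⁻ ξ, (jap ξ ^ s) ^ 2 * (∫⁻ τ, jap (τ + ξ ^ 2) ^ r * ‖h (ξ, τ)‖ₑ ^ 2) ∂μ := by
    intro r
    rw [energy, lintegral_prod _ (by fun_prop)]
    refine lintegral_congr fun ξ => ?_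
    rw [← lintegral_const_mul _ (by fun_prop)]
    refine lintegral_congr fun τ => ?_
    rw [freqWeight, mul_pow, modulation]
    ring
  rw [hE, hE, ← lintegral_const_mul' _ _ ENNReal.ofReal_ne_top]
  refine lintegral_mono_ae ?_
  filter_upwards [hfib, hfin] with ξ h1 h2
  rw [mul_left_comm]
  exact mul_le_mul_right (lintegral_rpow_mul_le (by fun_prop) (by positivity) hq₀ hq₁ h2.ne h1) _

end

/-! ### The estimate for a general frequency measure -/

section

variable {μ : Measure ℝ} {u u' u₁ u₂ v₁ v₂ h h' : ℝ × ℝ → ℂ}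

theorem IsTempered.congr (hu : IsTempered u) (huv : u =ᵐ[volume] u') : IsTempered u' := by
  obtain ⟨N, hN⟩ := hu
  refine ⟨N, hN.congr ?_⟩
  filter_upwards [huv] with p hp
  rw [hp]

theorem toDistribution_congr (huv : u =ᵐ[volume] u') : toDistribution u = toDistribution u' := by
  by_cases hu : IsTempered u
  · ext φ
    rw [toDistribution_apply hu, toDistribution_apply (hu.congr huv)]
    refine integral_congr_ae ?_
    filter_upwards [huv] with p hp
    rw [hp]
  · rw [toDistribution, toDistribution, dif_neg hu, dif_neg fun hu' => hu (hu'.congr huv.symm)]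

theorem HasFourierTransform.congr {Λ : 𝓢'(ℝ × ℝ, ℂ)} (hh : HasFourierTransform μ Λ h)
    (e : h =ᵐ[μ.prod volume] h') : HasFourierTransform μ Λ h' := by
  refine ⟨hh.1.congr e, fun φ => ?_⟩
  have e' : (fun q => φ q * h q) =ᵐ[μ.prod volume] fun q => φ q * h' q := by
    filter_upwards [e] with q hq
    rw [hq]
  exact ⟨(hh.2 φ).1.congr e', (hh.2 φ).2.trans (integral_congr_ae e')⟩

theorem eLpNorm_weight_sq (μ : Measure ℝ) (s b : ℝ) (h : ℝ × ℝ → ℂ) :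
    eLpNorm (fun q : ℝ × ℝ => ((bracket q.1 ^ s * bracket (q.2 + q.1 ^ 2) ^ b : ℝ) : ℂ) * h q)
      2 (μ.prod volume) ^ 2 =
    ∫⁻ q, (jap (modulation q) ^ b * (jap q.1 ^ s * ‖h q‖ₑ)) ^ 2 ∂μ.prod volume := by
  rw [eLpNorm_two_sq]
  refine lintegral_congr fun q => ?_
  have p1 := bracket_pos q.1
  have p2 := bracket_pos (q.2 + q.1 ^ 2)
  rw [enorm_mul, ← ofReal_norm (((_ : ℝ) : ℂ)), Complex.norm_real,
    Real.norm_of_nonneg (by positivity), ENNReal.ofReal_mul (by positivity), ← jap_rpow, ← jap_rpow,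
    modulation]
  ring

/-- Any bound above the infimum in `xNorm` holds for a Borel measurable representative of the
Fourier transform. -/
theorem exists_transform_lt {Λ : 𝓢'(ℝ × ℝ, ℂ)} {s b : ℝ} {r : ℝ≥0∞} (hr : xNorm μ s b Λ < r) :
    ∃ h : ℝ × ℝ → ℂ, Measurable h ∧ HasFourierTransform μ Λ h ∧
      ∫⁻ q, (jap (modulation q) ^ b * (jap q.1 ^ s * ‖h q‖ₑ)) ^ 2 ∂μ.prod volume ≤ r ^ 2 := by
  rw [xNorm, iInf_lt_iff] at hr
  obtain ⟨h, hr⟩ := hr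
  rw [iInf_lt_iff] at hr
  obtain ⟨hh, hr⟩ := hr
  refine ⟨hh.1.mk h, hh.1.stronglyMeasurable_mk.measurable, hh.congr hh.1.ae_eq_mk, ?_⟩
  rw [← eLpNorm_weight_sq]
  refine pow_le_pow_left' (le_trans (le_of_eq ?_) hr.le) 2
  refine eLpNorm_congr_ae ?_
  filter_upwards [hh.1.ae_eq_mk] with q hq
  rw [← hq]

theorem energy_one_eq (μ : Measure ℝ) (s : ℝ) (h : ℝ × ℝ → ℂ) :
    energy μ s 1 (fun z => ‖h z‖ₑ) =
      ∫⁻ q, (jap (modulation q) ^ (1 / 2 : ℝ) * (jap q.1 ^ s * ‖h q‖ₑ)) ^ 2 ∂μ.prod volume := by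
  refine lintegral_congr fun q => ?_
  rw [mul_pow (jap (modulation q) ^ (1 / 2 : ℝ)), jap_rpow_sq, freqWeight]
  norm_num

theorem lintegral_sq_le_energy {s : ℝ} (hs : 0 ≤ s) (h : ℝ × ℝ → ℂ) :
    ∫⁻ q, ‖h q‖ₑ ^ 2 ∂μ.prod volume ≤ energy μ s 1 (fun z => ‖h z‖ₑ) := by
  refine lintegral_mono fun q => ?_
  refine le_trans ?_ (le_mul_of_one_le_left' (one_le_jap_rpow _ zero_le_one))
  exact pow_le_pow_left' (le_mul_of_one_le_left' (one_le_jap_rpow _ hs)) 2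

theorem enorm_productTransform_le (h₁ h₂ : ℝ × ℝ → ℂ) (Q : ℝ × ℝ) :
    ‖Complex.I * Q.1 * productTransform μ h₁ h₂ Q‖ₑ ≤
      jap Q.1 * crossConv μ (fun z => ‖h₁ z‖ₑ) (fun z => ‖h₂ z‖ₑ) Q := by
  have hI : ‖Complex.I‖ₑ = 1 := by
    rw [← ofReal_norm, Complex.norm_I, ENNReal.ofReal_one]
  rw [enorm_mul, enorm_mul, hI, one_mul, productTransform, enorm_mul]
  refine mul_le_mul' ?_ ?_
  · rw [← ofReal_norm, Complex.norm_real]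
    exact ENNReal.ofReal_le_ofReal (abs_le_bracket _)
  · refine (mul_le_of_le_one_left' ?_).trans ?_
    · rw [← ofReal_norm, Complex.norm_real, ENNReal.ofReal_le_one,
        Real.norm_of_nonneg (by positivity)]
      refine inv_le_one_of_one_le₀ ?_
      nlinarith [Real.pi_gt_three]
    · refine (enorm_integral_le_lintegral_enorm _).trans_eq ?_
      simp only [enorm_mul, RCLike.enorm_conj, crossConv]

theorem le_of_sq_le_sq_ennreal {a b : ℝ≥0∞} (h : a ^ 2 ≤ b ^ 2) : a ≤ b :=
  (ENNReal.pow_right_strictMono two_ne_zero).le_iff_le.mp h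

/-- Upper bounds that hold for all larger `x` and `y` pass to the limit; finiteness of `X` and `Y`
excludes the indeterminate products `0 * ∞`. -/
theorem le_mul_of_forall_lt_le_mul {A K X Y : ℝ≥0∞} (hK : K ≠ ⊤) (hX : X < ⊤) (hY : Y < ⊤)
    (h : ∀ x y, X < x → x < ⊤ → Y < y → y < ⊤ → A ≤ K * (x * y)) : A ≤ K * (X * Y) := by
  have nX : (nhdsWithin X (Set.Ioi X)).NeBot := nhdsGT_neBot_of_exists_gt ⟨⊤, hX⟩
  have nY : (nhdsWithin Y (Set.Ioi Y)).NeBot := nhdsGT_neBot_of_exists_gt ⟨⊤, hY⟩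
  have h1 : ∀ y, Y < y → y < ⊤ → A ≤ K * (X * y) := by
    intro y hy hy'
    have ht : Filter.Tendsto (fun x => K * (x * y)) (nhdsWithin X (Set.Ioi X))
        (nhds (K * (X * y))) :=
      ENNReal.Tendsto.const_mul (ENNReal.Tendsto.mul_const
        (Filter.tendsto_id.mono_left nhdsWithin_le_nhds) (Or.inr hy'.ne)) (Or.inr hK)
    refine ge_of_tendsto ht ?_
    filter_upwards [self_mem_nhdsWithin, mem_nhdsWithin_of_mem_nhds (Iio_mem_nhds hX)] with x hx hx'
    exact h x y hx hx' hy hy'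
  have ht : Filter.Tendsto (fun y => K * (X * y)) (nhdsWithin Y (Set.Ioi Y))
      (nhds (K * (X * Y))) :=
    ENNReal.Tendsto.const_mul (ENNReal.Tendsto.const_mul
      (Filter.tendsto_id.mono_left nhdsWithin_le_nhds) (Or.inr hX.ne)) (Or.inr hK)
  refine ge_of_tendsto ht ?_
  filter_upwards [self_mem_nhdsWithin, mem_nhdsWithin_of_mem_nhds (Iio_mem_nhds hY)] with y hy hy'
  exact h1 y hy hy'

/-- The two estimates for a general frequency measure. The functions are square integrable against a
power weight only, so that lifts of periodic functions are covered. -/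
theorem exists_estimate (μ : Measure ℝ) [IsFrequencyMeasure μ] {θ s : ℝ} (hθ₀ : 0 < θ)
    (hθ₁ : θ < 1 / 4) (hs : 0 ≤ s) : ∃ c : ℝ, 0 < c ∧ ∀ T : ℝ, 0 < T → ∀ u₁ u₂ : ℝ × ℝ → ℂ,
      AEStronglyMeasurable u₁ volume → AEStronglyMeasurable u₂ volume →
      IsTemperedL2 u₁ → IsTemperedL2 u₂ → SupportedIn T u₁ → SupportedIn T u₂ →
      xNorm μ s (1 / 2) (toDistribution u₁) < ⊤ → xNorm μ s (1 / 2) (toDistribution u₂) < ⊤ →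
      xNorm μ s (-(1 / 2)) (dxLine (conjMul u₁ u₂)) ≤ ENNReal.ofReal (c * T ^ θ) *
        (xNorm μ s (1 / 2) (toDistribution u₁) * xNorm μ s (1 / 2) (toDistribution u₂)) ∧
      yNorm μ s (dxLine (conjMul u₁ u₂)) ≤ ENNReal.ofReal (c * T ^ θ) *
        (xNorm μ s (1 / 2) (toDistribution u₁) * xNorm μ s (1 / 2) (toDistribution u₂)) := by
  obtain ⟨C, hC, hbil⟩ := exists_bilinear_bound μ (q := 1 - 2 * θ) (s := s) (by linarith)
    (by linarith) hs
  obtain ⟨D, hD, hloc⟩ := exists_energy_le μ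
  set c : ℝ := Real.sqrt (6 * C.toReal * (4 * D) ^ (2 * θ)) + 1 with hc
  have hcpos : 0 < c := by positivity
  refine ⟨c, hcpos, fun T hT u₁ u₂ a₁ a₂ t₁ t₂ s₁ s₂ f₁ f₂ => ?_⟩
  -- the functions may be replaced by Borel measurable representatives
  wlog hm : Measurable u₁ ∧ Measurable u₂ generalizing u₁ u₂
  · have key : ∀ u : ℝ × ℝ → ℂ, AEStronglyMeasurable u volume → IsTemperedL2 u → SupportedIn T u →
        ∃ v, u =ᵐ[volume] v ∧ Measurable v ∧ IsTemperedL2 v ∧ SupportedIn T v := by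
      intro u a t su
      refine ⟨a.mk u, a.ae_eq_mk, a.stronglyMeasurable_mk.measurable, ?_, ?_⟩
      · obtain ⟨N, hN⟩ := t
        refine ⟨N, hN.ae_eq ?_⟩
        filter_upwards [a.ae_eq_mk] with p hp
        rw [← hp]
      · filter_upwards [su, a.ae_eq_mk] with p hp hp' h
        rw [← hp', hp h]
    obtain ⟨v₁, e₁, mv₁, tv₁, sv₁⟩ := key u₁ a₁ t₁ s₁
    obtain ⟨v₂, e₂, mv₂, tv₂, sv₂⟩ := key u₂ a₂ t₂ s₂
    have e : conjMul u₁ u₂ =ᵐ[volume] conjMul v₁ v₂ := by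
      filter_upwards [e₁, e₂] with p hp₁ hp₂
      rw [conjMul, conjMul, hp₁, hp₂]
    rw [toDistribution_congr e₁] at f₁ ⊢
    rw [toDistribution_congr e₂] at f₂ ⊢
    rw [show dxLine (conjMul u₁ u₂) = dxLine (conjMul v₁ v₂) by
      rw [dxLine, dxLine, toDistribution_congr e]]
    exact this v₁ v₂ mv₁.aestronglyMeasurable mv₂.aestronglyMeasurable tv₁ tv₂ sv₁ sv₂ f₁ f₂
      ⟨mv₁, mv₂⟩
  obtain ⟨m₁, m₂⟩ := hm
  have hK : ENNReal.ofReal (c * T ^ θ) ≠ ⊤ := ENNReal.ofReal_ne_top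
  have hconst : C * (2 * ENNReal.ofReal (3 * (4 * (D * T)) ^ (1 - (1 - 2 * θ)))) ≤
      ENNReal.ofReal (c * T ^ θ) ^ 2 := by
    rw [← ENNReal.ofReal_toReal hC, ← ENNReal.ofReal_ofNat 2, ← ENNReal.ofReal_mul (by norm_num),
      ← ENNReal.ofReal_mul ENNReal.toReal_nonneg, ← ENNReal.ofReal_pow (by positivity)]
    refine ENNReal.ofReal_le_ofReal ?_
    have e1 : (T ^ θ) ^ 2 = T ^ (2 * θ) := by
      rw [← Real.rpow_natCast, ← Real.rpow_mul hT.le]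
      congr 1
      push_cast
      ring
    have e2 : 6 * C.toReal * (4 * D) ^ (2 * θ) ≤ c ^ 2 := by
      have h1 : 0 ≤ 6 * C.toReal * (4 * D) ^ (2 * θ) := by positivity
      have h2 := Real.sq_sqrt h1
      have h3 := Real.sqrt_nonneg (6 * C.toReal * (4 * D) ^ (2 * θ))
      rw [hc]
      nlinarith
    rw [sub_sub_cancel, ← mul_assoc 4 D T, Real.mul_rpow (by positivity) hT.le, mul_pow, e1]
    calc C.toReal * (2 * (3 * ((4 * D) ^ (2 * θ) * T ^ (2 * θ))))
        = (6 * C.toReal * (4 * D) ^ (2 * θ)) * T ^ (2 * θ) := by ring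
      _ ≤ _ := by gcongr
  have main : ∀ x y, xNorm μ s (1 / 2) (toDistribution u₁) < x → x < ⊤ →
      xNorm μ s (1 / 2) (toDistribution u₂) < y → y < ⊤ →
      xNorm μ s (-(1 / 2)) (dxLine (conjMul u₁ u₂)) ≤ ENNReal.ofReal (c * T ^ θ) * (x * y) ∧
      yNorm μ s (dxLine (conjMul u₁ u₂)) ≤ ENNReal.ofReal (c * T ^ θ) * (x * y) := by
    intro x y hx hx' hy hy'
    obtain ⟨h₁, mh₁, hh₁, b₁⟩ := exists_transform_lt hx
    obtain ⟨h₂, mh₂, hh₂, b₂⟩ := exists_transform_lt hy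
    rw [← energy_one_eq] at b₁ b₂
    have L₁ : ∫⁻ q, ‖h₁ q‖ₑ ^ 2 ∂μ.prod volume ≠ ⊤ :=
      (((lintegral_sq_le_energy hs h₁).trans b₁).trans_lt (ENNReal.pow_lt_top hx')).ne
    have L₂ : ∫⁻ q, ‖h₂ q‖ₑ ^ 2 ∂μ.prod volume ≠ ⊤ :=
      (((lintegral_sq_le_energy hs h₂).trans b₂).trans_lt (ENNReal.pow_lt_top hy')).ne
    have hH := hasFourierTransform_dxLine_conjMul m₁ m₂ t₁ t₂ mh₁ mh₂ L₁ L₂ hh₁ hh₂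
    have g₁ := hloc hT t₁.isTempered s₁ mh₁ L₁ hh₁ (s := s) (q := 1 - 2 * θ) (by linarith)
      (by linarith)
    have g₂ := hloc hT t₂.isTempered s₂ mh₂ L₂ hh₂ (s := s) (q := 1 - 2 * θ) (by linarith)
      (by linarith)
    set E₁ := energy μ s 1 (fun z => ‖h₁ z‖ₑ) with hE₁
    set E₂ := energy μ s 1 (fun z => ‖h₂ z‖ₑ) with hE₂
    set κ := ENNReal.ofReal (3 * (4 * (D * T)) ^ (1 - (1 - 2 * θ))) with hκ
    obtain ⟨bX, bY⟩ := hbil (fun z => ‖h₁ z‖ₑ) (fun z => ‖h₂ z‖ₑ) (by fun_prop) (by fun_prop)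
    have hfinal : C * (E₁ * energy μ s (1 - 2 * θ) (fun z => ‖h₂ z‖ₑ) +
        E₂ * energy μ s (1 - 2 * θ) (fun z => ‖h₁ z‖ₑ)) ≤
        (ENNReal.ofReal (c * T ^ θ) * (x * y)) ^ 2 := by
      calc _ ≤ C * (E₁ * (κ * E₂) + E₂ * (κ * E₁)) := by gcongr
        _ = C * (2 * κ) * (E₁ * E₂) := by ring
        _ ≤ ENNReal.ofReal (c * T ^ θ) ^ 2 * (x ^ 2 * y ^ 2) := by gcongr
        _ = _ := by ring
    constructor
    · refine (iInf₂_le _ hH).trans (le_of_sq_le_sq_ennreal ?_)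
      rw [eLpNorm_weight_sq]
      refine le_trans (lintegral_mono fun Q => ?_) (bX.trans hfinal)
      gcongr
      exact enorm_productTransform_le h₁ h₂ Q
    · refine (iInf₂_le _ hH).trans ?_
      refine (ENNReal.rpow_le_rpow (le_trans (lintegral_mono fun ξ => ?_) (bY.trans hfinal))
        (by norm_num)).trans_eq ?_
      · have hmeas : Measurable fun τ : ℝ => ENNReal.ofReal ((bracket (τ + ξ ^ 2))⁻¹) *
            ‖Complex.I * ((ξ, τ) : ℝ × ℝ).1 * productTransform μ h₁ h₂ (ξ, τ)‖ₑ := by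
          have hb := continuous_bracket.measurable
          have mH := measurable_productTransform (μ := μ) mh₁ mh₂
          fun_prop
        rw [mul_comm 2 s, Real.rpow_mul (bracket_pos ξ).le, Real.rpow_two,
          ENNReal.ofReal_pow (by have := bracket_pos ξ; positivity), ← jap_rpow, ← mul_pow,
          ← lintegral_const_mul _ hmeas]
        refine pow_le_pow_left' (lintegral_mono fun τ => ?_) 2
        rw [mul_left_comm, ← Real.rpow_neg_one, ← jap_rpow]
        change _ ≤ jap (τ + ξ ^ 2) ^ (-1 : ℝ) * _
        gcongr
        exact enorm_productTransform_le h₁ h₂ (ξ, τ)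
      · rw [← ENNReal.rpow_two, ← ENNReal.rpow_mul]
        norm_num
  exact ⟨le_mul_of_forall_lt_le_mul hK f₁ f₂ fun x y hx hx' hy hy' => (main x y hx hx' hy hy').1,
    le_mul_of_forall_lt_le_mul hK f₁ f₂ fun x y hx hx' hy hy' => (main x y hx hx' hy hy').2⟩

/-! ### Periodic functions -/

theorem lintegral_eq_tsum_period (f : ℝ → ℝ≥0∞) :
    ∫⁻ x, f x = ∑' n : ℤ, ∫⁻ x in Set.Ioc (n * (2 * Real.pi)) (n * (2 * Real.pi) + 2 * Real.pi),
      f x := by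
  have h1 := iUnion_Ioc_zsmul (α := ℝ) Real.two_pi_pos
  have h2 := Set.pairwise_disjoint_Ioc_zsmul (2 * Real.pi)
  rw [← setLIntegral_univ, ← h1, lintegral_iUnion (fun _ => measurableSet_Ioc) h2]
  refine tsum_congr fun n => ?_
  simp [zsmul_eq_mul, add_mul]

theorem quasiMeasurePreserving_coe_torus :
    Measure.QuasiMeasurePreserving (fun x : ℝ => (x : Torus)) volume volume := by
  refine ⟨AddCircle.measurable_mk', ?_⟩
  refine Measure.AbsolutelyContinuous.mk fun S hS h0 => ?_
  rw [Measure.map_apply AddCircle.measurable_mk' hS,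
    ← lintegral_indicator_one (AddCircle.measurable_mk' hS), lintegral_eq_tsum_period,
    ENNReal.tsum_eq_zero]
  intro n
  have h1 := AddCircle.lintegral_preimage (2 * Real.pi) (n * (2 * Real.pi)) (S.indicator 1)
  rw [lintegral_indicator_one hS, h0] at h1
  exact h1

/-- A periodic function is integrable against `⟨x⟩⁻²`, with a bound by its integral over a period:
the periods are summed with the weights `⟨n⟩⁻²`. -/
theorem exists_lintegral_periodic_le : ∃ C : ℝ≥0∞, C ≠ ⊤ ∧ ∀ g : Torus → ℝ≥0∞,
    ∫⁻ x : ℝ, jap x ^ (-2 : ℝ) * g x ≤ C * ∫⁻ y, g y := by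
  obtain ⟨C, hC, hb⟩ := IsFrequencyMeasure.decay (μ := intMeasure) 2 (by norm_num)
  have hb0 := hb 0
  rw [lintegral_intMeasure (by fun_prop)] at hb0
  simp only [sub_zero] at hb0
  refine ⟨9 * C, by finiteness, fun g => ?_⟩
  rw [lintegral_eq_tsum_period]
  have hn : ∀ n : ℤ, ∫⁻ x in Set.Ioc (n * (2 * Real.pi)) (n * (2 * Real.pi) + 2 * Real.pi),
      jap x ^ (-2 : ℝ) * g x ≤ 9 * jap n ^ (-2 : ℝ) * ∫⁻ y, g y := by
    intro n
    rw [← AddCircle.lintegral_preimage (2 * Real.pi) (n * (2 * Real.pi)) g,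
      ← lintegral_const_mul' _ _ (ENNReal.mul_ne_top (by simp) (jap_rpow_ne_top _ _))]
    refine setLIntegral_mono_ae' measurableSet_Ioc (Filter.Eventually.of_forall fun x hx => ?_)
    refine mul_le_mul_left ?_ _
    have hpi := Real.pi_gt_three
    have h1 : |(n : ℝ)| ≤ |x| + 1 := by
      rcases le_or_gt 0 n with h0 | h0
      · have h0' : (0 : ℝ) ≤ n := by exact_mod_cast h0
        rw [abs_of_nonneg h0']
        have := le_abs_self x
        nlinarith [hx.1]
      · have h0' : (n : ℝ) + 1 ≤ 0 := by exact_mod_cast h0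
        rw [abs_of_nonpos (by linarith)]
        have := neg_abs_le x
        nlinarith [hx.2]
    have h2 : bracket n ≤ 3 * bracket x := by
      linarith [bracket_le_one_add_abs (n : ℝ), abs_le_bracket x, one_le_bracket x]
    have h3 : jap n ≤ 3 * jap x := by
      refine (ENNReal.ofReal_le_ofReal h2).trans_eq ?_
      rw [ENNReal.ofReal_mul (by norm_num), jap]
      simp
    calc jap x ^ (-2 : ℝ) = 9 * (3 * jap x) ^ (-2 : ℝ) := by
          rw [ENNReal.mul_rpow_of_ne_zero (by norm_num) (jap_ne_zero _), ← mul_assoc,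
            show (9 : ℝ≥0∞) = 3 ^ (2 : ℝ) by rw [ENNReal.rpow_two]; norm_num,
            ← ENNReal.rpow_add _ _ (by norm_num) (by norm_num), add_neg_cancel, ENNReal.rpow_zero,
            one_mul]
      _ ≤ _ := mul_le_mul_right (ennreal_rpow_le_rpow_of_nonpos h3 (by norm_num)) _
  refine (ENNReal.tsum_le_tsum hn).trans ?_
  rw [ENNReal.tsum_mul_right, ENNReal.tsum_mul_left]
  gcongr

theorem quasiMeasurePreserving_lift :
    Measure.QuasiMeasurePreserving (fun p : ℝ × ℝ => ((p.1 : Torus), p.2)) volume volume :=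
  MeasureTheory.QuasiMeasurePreserving.prodMap quasiMeasurePreserving_coe_torus
    (Measure.QuasiMeasurePreserving.id volume)

theorem isTemperedL2_lift {u : Torus × ℝ → ℂ} (hu : MemLp u 2 volume) :
    IsTemperedL2 (lift u) := by
  obtain ⟨C, hC, hb⟩ := exists_lintegral_periodic_le
  have ha : AEStronglyMeasurable (lift u) volume :=
    hu.1.comp_quasiMeasurePreserving quasiMeasurePreserving_lift
  have hw : Continuous fun p : ℝ × ℝ => (((1 + ‖p‖) ^ 1)⁻¹ : ℝ) :=
    Continuous.inv₀ (by fun_prop) fun p => by positivity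
  refine ⟨1, hw.aestronglyMeasurable.smul ha, ?_⟩
  suffices h : ∫⁻ p, ‖(((1 + ‖p‖) ^ 1)⁻¹ : ℝ) • lift u p‖ₑ ^ 2 ≠ ⊤ by
    rw [← eLpNorm_two_sq] at h
    exact lt_top_iff_ne_top.mpr fun h' => h (by rw [h']; simp)
  have hpt : ∀ p : ℝ × ℝ, ‖(((1 + ‖p‖) ^ 1)⁻¹ : ℝ) • lift u p‖ₑ ^ 2 ≤
      jap p.1 ^ (-2 : ℝ) * ‖lift u p‖ₑ ^ 2 := by
    intro p
    rw [enorm_smul, mul_pow]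
    refine mul_le_mul_left ?_ _
    have h1 : bracket p.1 ≤ 1 + ‖p‖ := (bracket_le_one_add_abs _).trans (by
      gcongr; exact norm_fst_le p)
    have h2 := bracket_pos p.1
    rw [← ofReal_norm, Real.norm_of_nonneg (by positivity), ← ENNReal.ofReal_pow (by positivity),
      jap_rpow, Real.rpow_neg h2.le, Real.rpow_two, pow_one, inv_pow]
    refine ENNReal.ofReal_le_ofReal ?_
    gcongr
  refine ne_top_of_le_ne_top ?_ (lintegral_mono hpt)
  have haf : AEMeasurable (fun p : ℝ × ℝ => jap p.1 ^ (-2 : ℝ) * ‖lift u p‖ₑ ^ 2) volume :=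
    (Measurable.aemeasurable (by fun_prop)).mul (ha.enorm.pow_const 2)
  rw [Measure.volume_eq_prod, lintegral_prod _ (by rwa [← Measure.volume_eq_prod])]
  have h1 : ∀ x : ℝ, ∫⁻ t, jap x ^ (-2 : ℝ) * ‖lift u (x, t)‖ₑ ^ 2 =
      jap x ^ (-2 : ℝ) * (fun y : Torus => ∫⁻ t, ‖u (y, t)‖ₑ ^ 2) x := fun x =>
    lintegral_const_mul' _ _ (jap_rpow_ne_top _ _)
  simp only [h1]
  refine ne_top_of_le_ne_top ?_ (hb fun y : Torus => ∫⁻ t, ‖u (y, t)‖ₑ ^ 2)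
  rw [← lintegral_prod (fun p : Torus × ℝ => ‖u p‖ₑ ^ 2)
    (by rw [← Measure.volume_eq_prod]; exact hu.1.enorm.pow_const 2)]
  exact ENNReal.mul_ne_top hC (MemLp.lintegral_enorm_sq_ne_top hu)

theorem isTemperedL2_of_memLp (hu : MemLp u 2 volume) : IsTemperedL2 u :=
  ⟨0, by simpa using hu⟩

end

end BourgainSpace

end

theorem theorem3p1 (θ : ℝ) (hθ₀ : 0 < θ) (hθ₁ : θ < 1 / 4) (s : ℝ) (hs : 0 ≤ s) :
    ∃ c : ℝ, 0 < c ∧ ∀ T : ℝ, 0 < T →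
      -- the nonperiodic case
      (∀ u₁ u₂ : ℝ × ℝ → ℂ,
        BourgainSpace.MemXLine s (1 / 2) u₁ → BourgainSpace.MemXLine s (1 / 2) u₂ →
        BourgainSpace.SupportedIn T u₁ → BourgainSpace.SupportedIn T u₂ →
          BourgainSpace.xNorm volume s (-(1 / 2))
              (BourgainSpace.dxLine (BourgainSpace.conjMul u₁ u₂)) ≤
            ENNReal.ofReal (c * T ^ θ) *
              (BourgainSpace.xNormLine s (1 / 2) u₁ * BourgainSpace.xNormLine s (1 / 2) u₂) ∧
          BourgainSpace.yNorm volume s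
              (BourgainSpace.dxLine (BourgainSpace.conjMul u₁ u₂)) ≤
            ENNReal.ofReal (c * T ^ θ) *
              (BourgainSpace.xNormLine s (1 / 2) u₁ * BourgainSpace.xNormLine s (1 / 2) u₂)) ∧
      -- the periodic case
      (∀ u₁ u₂ : BourgainSpace.Torus × ℝ → ℂ,
        BourgainSpace.MemXTorus s (1 / 2) u₁ → BourgainSpace.MemXTorus s (1 / 2) u₂ →
        BourgainSpace.SupportedIn T u₁ → BourgainSpace.SupportedIn T u₂ →
          BourgainSpace.xNorm BourgainSpace.intMeasure s (-(1 / 2))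
              (BourgainSpace.dxTorus (BourgainSpace.conjMul u₁ u₂)) ≤
            ENNReal.ofReal (c * T ^ θ) *
              (BourgainSpace.xNormTorus s (1 / 2) u₁ * BourgainSpace.xNormTorus s (1 / 2) u₂) ∧
          BourgainSpace.yNorm BourgainSpace.intMeasure s
              (BourgainSpace.dxTorus (BourgainSpace.conjMul u₁ u₂)) ≤
            ENNReal.ofReal (c * T ^ θ) *
              (BourgainSpace.xNormTorus s (1 / 2) u₁ * BourgainSpace.xNormTorus s (1 / 2) u₂)) := by
  obtain ⟨c₁, hc₁, h₁⟩ := BourgainSpace.exists_estimate volume hθ₀ hθ₁ hs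
  obtain ⟨c₂, hc₂, h₂⟩ := BourgainSpace.exists_estimate BourgainSpace.intMeasure hθ₀ hθ₁ hs
  refine ⟨max c₁ c₂, lt_max_of_lt_left hc₁, fun T hT => ⟨fun u₁ u₂ m₁ m₂ s₁ s₂ => ?_,
    fun u₁ u₂ m₁ m₂ s₁ s₂ => ?_⟩⟩
  · have hle : ENNReal.ofReal (c₁ * T ^ θ) ≤ ENNReal.ofReal (max c₁ c₂ * T ^ θ) :=
      ENNReal.ofReal_le_ofReal (by gcongr; exact le_max_left _ _)
    obtain ⟨hX, hY⟩ := h₁ T hT u₁ u₂ m₁.1.1 m₂.1.1 (BourgainSpace.isTemperedL2_of_memLp m₁.1)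
      (BourgainSpace.isTemperedL2_of_memLp m₂.1) s₁ s₂ m₁.2 m₂.2
    exact ⟨hX.trans (mul_le_mul_left hle _), hY.trans (mul_le_mul_left hle _)⟩
  · have hle : ENNReal.ofReal (c₂ * T ^ θ) ≤ ENNReal.ofReal (max c₁ c₂ * T ^ θ) :=
      ENNReal.ofReal_le_ofReal (by gcongr; exact le_max_right _ _)
    obtain ⟨hX, hY⟩ := h₂ T hT (BourgainSpace.lift u₁) (BourgainSpace.lift u₂)
      (m₁.1.1.comp_quasiMeasurePreserving BourgainSpace.quasiMeasurePreserving_lift)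
      (m₂.1.1.comp_quasiMeasurePreserving BourgainSpace.quasiMeasurePreserving_lift)
      (BourgainSpace.isTemperedL2_lift m₁.1) (BourgainSpace.isTemperedL2_lift m₂.1)
      (BourgainSpace.quasiMeasurePreserving_lift.ae s₁)
      (BourgainSpace.quasiMeasurePreserving_lift.ae s₂) m₁.2 m₂.2
    exact ⟨hX.trans (mul_le_mul_left hle _), hY.trans (mul_le_mul_left hle _)⟩
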